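/- **Setting.** Let $\mathcal N$ be a nonempty finite set, $n=|\mathcal N|$, let $f\colon 2^{\mathcal N}\to\mathbb R_{\ge 0}$ be submodular, i.e. $f(X)+f(Y)\ge f(X\cup Y)+f(X\cap Y)$ for all $X,Y\subseteq\mathcal N$ ($f$ need not be monotone). Let $B>0$, let $0<c(u)\le B$ for every $u\in\mathcal N$, and put $c(X)=\sum_{u\in X}c(u)$. A set $X$ is *feasible* if $c(X)\le B$, and $\mathrm{OPT}=\max\{f(X)\colon X\text{ feasible}\}$. Write $f(u\mid X)=f(X\cup\{u\})-f(X)$. Let $0<\epsilon<1$. Let $\mathsf{USM}$ be any (possibly randomized) procedure that on input $X\subseteq\mathcal N$ returns a set $Y\subseteq X$ with $\max_{Z\subseteq X}f(Z)\le(2+\epsilon)\,\mathbb E[f(Y)]$. All calls of random procedures below use fresh independent randomness, and ties are broken arbitrarily. **$\mathsf{GetSEQ}(A,I)$.** Start with the empty sequence $V$. While $I\ne\emptyset$: order $I$ uniformly at random as $v_1,\dots,v_{|I|}$; let $s$ be the largest $i\le |I|$ such that $A\cup V\cup\{v_1,\dots,v_i\}$ is feasible; append $v_1,\dots,v_s$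 to $V$; replace $I$ by $\{u\in I\setminus V\colon A\cup V\cup\{u\}\text{ feasible}\}$. Return $V$. **$\mathsf{RandBatch}(\rho,I,M,p,\epsilon)$.** Start with $A=U=\emptyset$, $count=0$, and $L=\{u\in I\colon f(u\mid A)/c(u)\ge\rho,\ A\cup\{u\}\text{ feasible}\}$. While $L\neq\emptyset$ and $count<M$: let $(v_1,\dots,v_d)=\mathsf{GetSEQ}(A,L)$; for $0\le i\le d$ put $V_i=\{v_1,\dots,v_i\}$, $G_i=A\cup V_i$, $E_i^+=\{u\in L\colon f(u\mid G_i)/c(u)\ge\rho,\ G_i\cup\{u\}\text{ feasible}\}$, $E_i^-=\{u\in L\colon f(u\mid G_i)<0\}$, $D_i=\{v_j\colon j\le i,\ f(v_j\mid A\cup V_{j-1})<0\}$; let $t_1$ be the least $i\le d$ with $c(E_i^+)\le(1-\epsilon)c(L)$ and $t_2$ the least $i\le d$ with $\epsilon\sum_{u\in E_i^+}f(u\mid G_i)\le\sum_{u\in E_i^-}|f(u\mid G_i)|+\sum_{v_j\in D_i}|f(v_j\mid A\cup V_{j-1})|$; let $t^*=\min\{t_1,t_2\}$ and replace $U$ by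 $U\cup V_{t^*}$; with probability $p$, replace $A$ by $A\cup V_{t^*}$ and, if $t_2<t_1$, increase $count$ by $1$; finally replace $L$ by $\{u\in L\setminus U\colon f(u\mid A)/c(u)\ge\rho,\ A\cup\{u\}\text{ feasible}\}$. Return $(A,U,L)$. **$\mathsf{Probe}(\rho,\mathcal N_1,\mathcal N_2,\epsilon)$.** Let $M=\lceil\epsilon^{-2}\rceil$; let $A_1$ be the first output of $\mathsf{RandBatch}(\rho,\mathcal N_1,M,1,\epsilon)$ and $A_2$ the first output of $\mathsf{RandBatch}(\rho,\mathcal N_1\setminus A_1,M,1,\epsilon)$. For $i=1,2$ let $e_i$ maximize $f(A_i\cup\{u\})$ over $u\in\mathcal N_1$ with $c(A_i\cup\{u\})\le B$ (if there is no such $u$, the candidate $A_i\cup\{e_i\}$ is omitted). If $c(\mathcal N_2\cup A_1)\le B$, let $A_3=\mathsf{USM}(\mathcal N_2\cup A_1)$. Return a set with maximum $f$-value among $\emptyset,A_1,A_1\cup\{e_1\},A_2,A_2\cup\{e_2\}$ and, if defined, $A_3$. **$\mathsf{ParSKP}(\alpha,\epsilon,f,c)$.** Let $\mathcal N_1=\{u\in\mathcal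 N\colon c(u)>\epsilon B/n\}$, $\mathcal N_2=\mathcal N\setminus\mathcal N_1$, $u^*\in\arg\max_{u\in\mathcal N}f(\{u\})$, $\rho_{\min}=\alpha f(\{u^*\})/B$, $\rho_{\max}=n^2\alpha f(\{u^*\})/(\epsilon B)$, and $Z=\{(1-\epsilon)^{-z}\colon z\in\mathbb Z\}\cap[\rho_{\min},\rho_{\max}]$. For every $\rho\in Z$ run $\mathsf{Probe}(\rho,\mathcal N_1,\mathcal N_2,\epsilon)$ independently $\lceil\log_{1-\epsilon}\epsilon\rceil$ times. Return a set $S$ with maximum $f$-value among $\mathsf{USM}(\mathcal N_2)$, $\{u^*\}$ and all the sets returned by these runs of $\mathsf{Probe}$. **Theorem.** In this setting, $\mathsf{ParSKP}$ run with $\alpha=\frac14$ always returns a feasible set $S$ (i.e. $c(S)\le B$), and $$\mathbb E[f(S)]\ \ge\ \Bigl(\frac18-\epsilon\Bigr)\mathrm{OPT}.$$ -/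

import Mathlib

open scoped NNReal

noncomputable section

namespace KnapsackSubmodular

universe u

variable {N : Type u} [Fintype N] [DecidableEq N]

/-- Submodularity of a set function on the finite ground set `N`. -/
def Submodular (f : Finset N → ℝ) : Prop :=
  ∀ X Y : Finset N, f (X ∪ Y) + f (X ∩ Y) ≤ f X + f Y

/-- The modular cost `c(X) = ∑_{u ∈ X} c(u)`. -/
def cost (c : N → ℝ) (X : Finset N) : ℝ := ∑ u ∈ X, c u

/-- The knapsack constraint `c(X) ≤ B`. -/
def Feasible (c : N → ℝ) (B : ℝ) (X : Finset N) : Prop := cost c X ≤ B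

/-- The optimal value: the maximum of `f` over all feasible sets. -/
def OPT (f : Finset N → ℝ) (c : N → ℝ) (B : ℝ) : ℝ :=
  sSup (f '' {X | Feasible c B X})

/-- The marginal gain `f(u ∣ X) = f(X ∪ {u}) - f(X)`. -/
def marginal (f : Finset N → ℝ) (u : N) (X : Finset N) : ℝ := f (insert u X) - f X

/-- The expectation of `g(S)` for a random subset `S` of `N` with law `P`. -/
def expect (P : PMF (Finset N)) (g : Finset N → ℝ) : ℝ := ∑ S : Finset N, (P S).toReal * g S

/-- `usm` is a (possibly randomized) procedure for unconstrained submodular maximization with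
approximation ratio `r`: on input `X` it outputs a random `Y ⊆ X` such that
`max {f(Z) : Z ⊆ X} ≤ r · 𝔼[f(Y)]`. -/
def IsUSM (r : ℝ) (f : Finset N → ℝ) (usm : Finset N → PMF (Finset N)) : Prop :=
  ∀ X : Finset N, (∀ Y ∈ (usm X).support, Y ⊆ X) ∧ ∀ Z ⊆ X, f Z ≤ r * expect (usm X) f

/-- Such procedures exist for every ratio `r ≥ 1`. -/
theorem exists_isUSM {N : Type u} [Fintype N] (f : Finset N → ℝ) (hf : ∀ X, 0 ≤ f X) {r : ℝ} (hr : 1 ≤ r) :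
    ∃ usm, IsUSM r f usm := by
  classical
  have h : ∀ X : Finset N, ∃ Y ∈ X.powerset, ∀ Z ∈ X.powerset, f Z ≤ f Y := fun X =>
    Finset.exists_max_image _ _ ⟨∅, by simp⟩
  choose g hg hmax using h
  refine ⟨fun X => PMF.pure (g X), fun X => ⟨?_, fun Z hZ => ?_⟩⟩
  · intro Y hY
    rw [PMF.mem_support_pure_iff] at hY
    exact hY ▸ Finset.mem_powerset.1 (hg X)
  · have he : expect (PMF.pure (g X)) f = f (g X) := by
      unfold expect
      rw [Finset.sum_eq_single (g X)]
      · simp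
      · intro b _ hb
        simp [PMF.pure_apply, hb]
      · simp
    rw [he]
    have h1 := hmax X Z (Finset.mem_powerset.2 hZ)
    nlinarith [hf (g X)]

/-- A uniformly random ordering of the elements of `I`. -/
def randPerm (I : Finset N) : PMF (List N) :=
  haveI : Nonempty (Fin I.card ≃ I) := ⟨I.equivFin.symm⟩
  (PMF.uniformOfFintype (Fin I.card ≃ I)).map fun σ => List.ofFn fun i => (σ i : N)

/-- The while-loop of `GetSEQ`, run for at most `k` rounds; `V` is the sequence built so far and
`I` the set of elements that still fit. -/
def getSeqLoop (c : N → ℝ) (B : ℝ) (A : Finset N) : ℕ → List N → Finset N → PMF (List N)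
  | 0, V, _ => PMF.pure V
  | k + 1, V, I =>
    open Classical in
    if I = ∅ then PMF.pure V else
    (randPerm I).bind fun l =>
      let s := Nat.findGreatest
        (fun i => Feasible c B (A ∪ V.toFinset ∪ (l.take i).toFinset)) l.length
      let V' := V ++ l.take s
      getSeqLoop c B A k V'
        (I.filter fun u => u ∉ V' ∧ Feasible c B (insert u (A ∪ V'.toFinset)))

/-- `GetSEQ(A, I, c)`. In every round either the first element `v₁` of the random ordering enters
`V`, or `v₁` does not fit; in both cases it leaves `I`. Hence the loop ends within `|I|` rounds. -/
def getSeq (c : N → ℝ) (B : ℝ) (A I : Finset N) : PMF (List N) :=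
  getSeqLoop c B A I.card [] I

/-- `G_i = A ∪ {v₁, …, v_i}`. -/
def prefixSet (A : Finset N) (v : List N) (i : ℕ) : Finset N := A ∪ (v.take i).toFinset

/-- The elements of `I` that fit into `A` and have marginal density at least `ρ` w.r.t. `A`. -/
def valuable (f : Finset N → ℝ) (c : N → ℝ) (B ρ : ℝ) (I A : Finset N) : Finset N :=
  open Classical in
  I.filter fun u => ρ ≤ marginal f u A / c u ∧ Feasible c B (insert u A)

/-- The elements of `L` with negative marginal gain w.r.t. `A`. -/
def harmful (f : Finset N → ℝ) (L A : Finset N) : Finset N :=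
  L.filter fun u => marginal f u A < 0

/-- `∑_{v_j ∈ D_i} |f(v_j ∣ A ∪ V_{j-1})|`, where `D_i` consists of those `v_j` with `j ≤ i` and
`f(v_j ∣ A ∪ V_{j-1}) < 0`. In the code positions in `v` are counted from `0`, so that
`prefixSet A v j` contains exactly the elements of `v` preceding `v.get j`. -/
def prefixLoss (f : Finset N → ℝ) (A : Finset N) (v : List N) (i : ℕ) : ℝ :=
  ∑ j : Fin v.length with j.val < i ∧ marginal f (v.get j) (prefixSet A v j.val) < 0,
    |marginal f (v.get j) (prefixSet A v j.val)|

/-- `t₁`: the least `i ≤ d` with `c(E_i⁺) ≤ (1 - ε) c(L)`. For `ρ > 0` and a sequence `v` made by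
`GetSEQ` the index `i = d` always qualifies, since then `E_d⁺ = ∅`; the same holds for `t₂`. -/
def t₁ (f : Finset N → ℝ) (c : N → ℝ) (B ρ ε : ℝ) (A L : Finset N) (v : List N) : ℕ :=
  sInf {i | i ≤ v.length ∧
    cost c (valuable f c B ρ L (prefixSet A v i)) ≤ (1 - ε) * cost c L}

/-- `t₂`: the least `i ≤ d` with
`ε ∑_{u ∈ E_i⁺} f(u ∣ G_i) ≤ ∑_{u ∈ E_i⁻} |f(u ∣ G_i)| + ∑_{v_j ∈ D_i} |f(v_j ∣ A ∪ V_{j-1})|`. -/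
def t₂ (f : Finset N → ℝ) (c : N → ℝ) (B ρ ε : ℝ) (A L : Finset N) (v : List N) : ℕ :=
  sInf {i | i ≤ v.length ∧
    ε * ∑ u ∈ valuable f c B ρ L (prefixSet A v i), marginal f u (prefixSet A v i) ≤
      ∑ u ∈ harmful f L (prefixSet A v i), |marginal f u (prefixSet A v i)| +
        prefixLoss f A v i}

/-- A biased coin: `true` with probability `p`, `false` with probability `1 - p`. -/
def coin (p : ℝ≥0) (hp : p ≤ 1) : PMF Bool :=
  PMF.ofFintype (fun b => if b then (p : ENNReal) else 1 - p) (by simp [hp])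

/-- The while-loop of `RandBatch`, run for at most `k` rounds from the state `(A, U, L, count)`. -/
def randBatchLoop (f : Finset N → ℝ) (c : N → ℝ) (B ρ : ℝ) (M : ℕ) (p : ℝ≥0) (hp : p ≤ 1)
    (ε : ℝ) :
    ℕ → Finset N → Finset N → Finset N → ℕ → PMF (Finset N × Finset N × Finset N)
  | 0, A, U, L, _ => PMF.pure (A, U, L)
  | k + 1, A, U, L, count =>
    if L = ∅ ∨ M ≤ count then PMF.pure (A, U, L) else
    (getSeq c B A L).bind fun v =>
      let i₁ := t₁ f c B ρ ε A L v
      let i₂ := t₂ f c B ρ ε A L v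
      let V := (v.take (min i₁ i₂)).toFinset
      let U' := U ∪ V
      (coin p hp).bind fun accept =>
        let A' := if accept then A ∪ V else A
        let count' := if accept ∧ i₂ < i₁ then count + 1 else count
        randBatchLoop f c B ρ M p hp ε k A' U' (valuable f c B ρ (L \ U') A') count'

/-- `RandBatch(ρ, I, M, p, ε, f, c)`, returning `(A, U, L)`. For `ρ > 0` and `ε > 0` each round
has `min t₁ t₂ ≥ 1`, so at least one element leaves `L` for good and the loop ends within `|I|`
rounds. -/
def randBatch (f : Finset N → ℝ) (c : N → ℝ) (B ρ : ℝ) (I : Finset N) (M : ℕ) (p : ℝ≥0)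
    (hp : p ≤ 1) (ε : ℝ) : PMF (Finset N × Finset N × Finset N) :=
  randBatchLoop f c B ρ M p hp ε I.card ∅ ∅ (valuable f c B ρ I ∅) 0

/-- `argmax_{X ∈ {S, T}} f(X)`. -/
def better (f : Finset N → ℝ) (S T : Finset N) : Finset N := if f S < f T then T else S

/-- `A ∪ {e}` with `e = argmax {f(A ∪ {u}) : u ∈ N₁, c(A ∪ {u}) ≤ B}`; it is `A` itself if there
is no such `u`. -/
def augment (f : Finset N → ℝ) (c : N → ℝ) (B : ℝ) (N₁ A : Finset N) : Finset N :=
  open Classical in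
  if h : (N₁.filter fun u => Feasible c B (insert u A)).Nonempty then
    insert (Finset.exists_max_image _ (fun u => f (insert u A)) h).choose A
  else A

/-- `Probe(ρ, N₁, N₂, ε, f, c)`, with the procedure `usm` as a subroutine. -/
def probe (f : Finset N → ℝ) (c : N → ℝ) (B : ℝ) (usm : Finset N → PMF (Finset N)) (ρ : ℝ)
    (N₁ N₂ : Finset N) (ε : ℝ) : PMF (Finset N) :=
  open Classical in
  let M := ⌈(ε ^ 2)⁻¹⌉₊
  (randBatch f c B ρ N₁ M 1 le_rfl ε).bind fun R₁ =>
  let A₁ := R₁.1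
  (randBatch f c B ρ (N₁ \ A₁) M 1 le_rfl ε).bind fun R₂ =>
  let A₂ := R₂.1
  let T₁ := better f (better f ∅ A₁) (augment f c B N₁ A₁)
  let T₂ := better f (better f T₁ A₂) (augment f c B N₁ A₂)
  if Feasible c B (N₂ ∪ A₁) then
    (usm (N₂ ∪ A₁)).map fun A₃ => better f T₂ A₃
  else PMF.pure T₂

/-- `k` independent runs of `P`, starting from the incumbent `S` and always keeping the better
set. -/
def bestOfRuns (f : Finset N → ℝ) (P : PMF (Finset N)) : ℕ → Finset N → PMF (Finset N)
  | 0, S => PMF.pure S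
  | k + 1, S => P.bind fun T => bestOfRuns f P k (better f S T)

/-- For every threshold `ρ` in the list, `K` independent runs of `P ρ`, always keeping the better
set. -/
def bestOverThresholds (f : Finset N → ℝ) (P : ℝ → PMF (Finset N)) (K : ℕ) :
    List ℝ → Finset N → PMF (Finset N)
  | [], S => PMF.pure S
  | ρ :: Z, S => (bestOfRuns f (P ρ) K S).bind fun S' => bestOverThresholds f P K Z S'

/-- `{(1 - ε)^{-z} : z ∈ ℤ} ∩ [lo, hi]`. -/
def thresholdSet (ε lo hi : ℝ) : Set ℝ := {ρ | (∃ z : ℤ, ρ = (1 - ε) ^ (-z)) ∧ ρ ∈ Set.Icc lo hi}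

/-- The threshold set is finite for the values of `lo` and `hi` that occur in the algorithm. -/
theorem thresholdSet_finite {ε lo hi : ℝ} (h0 : 0 < ε) (h1 : ε < 1) (h : 0 < lo ∨ hi ≤ 0) :
    (thresholdSet ε lo hi).Finite := by
  have hε : 0 < 1 - ε := by linarith
  have hb : 1 < (1 - ε)⁻¹ := (one_lt_inv₀ hε).2 (by linarith)
  rcases h with h | h
  · obtain ⟨m, hm⟩ := pow_unbounded_of_one_lt hi hb
    obtain ⟨k, hk⟩ := pow_unbounded_of_one_lt lo⁻¹ hb
    refine ((Set.finite_Icc (-(k : ℤ)) (m : ℤ)).image fun z : ℤ => (1 - ε) ^ (-z)).subset ?_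
    rintro ρ ⟨⟨z, rfl⟩, hlo, hhi⟩
    refine ⟨z, ⟨?_, ?_⟩, rfl⟩
    · by_contra hz
      push Not at hz
      have h2 : ((1 - ε)⁻¹) ^ z < ((1 - ε)⁻¹) ^ (-(k : ℤ)) := zpow_lt_zpow_right₀ hb hz
      rw [zpow_neg, zpow_natCast] at h2
      have h3 : (((1 - ε)⁻¹) ^ k)⁻¹ < lo := inv_lt_of_inv_lt₀ h hk
      rw [zpow_neg, ← inv_zpow] at hlo
      linarith
    · by_contra hz
      push Not at hz
      have h2 : ((1 - ε)⁻¹) ^ (m : ℤ) < ((1 - ε)⁻¹) ^ z := zpow_lt_zpow_right₀ hb hz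
      rw [zpow_natCast] at h2
      rw [zpow_neg, ← inv_zpow] at hhi
      linarith
  · refine Set.finite_empty.subset ?_
    rintro ρ ⟨⟨z, rfl⟩, -, hhi⟩
    have := zpow_pos hε (-z)
    exact absurd hhi (by linarith)

/-- The elements of the threshold set as a list (in an arbitrary order). -/
def thresholds (ε lo hi : ℝ) : List ℝ :=
  open Classical in
  if h : (thresholdSet ε lo hi).Finite then h.toFinset.toList else []

/-- `u* = argmax_{u ∈ N} f({u})`. -/
def bestSingleton [Nonempty N] (f : Finset N → ℝ) : N :=
  (Finite.exists_max fun u : N => f {u}).choose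

/-- `ParSKP(α, ε, f, c)` with budget `B` and the procedure `usm` as a subroutine: the law of the
returned set. -/
def parSKP [Nonempty N] (usm : Finset N → PMF (Finset N)) (α ε : ℝ) (f : Finset N → ℝ)
    (c : N → ℝ) (B : ℝ) : PMF (Finset N) :=
  let n : ℝ := Fintype.card N
  let N₁ : Finset N := Finset.univ.filter fun u => ε * (B / n) < c u
  let N₂ : Finset N := Finset.univ \ N₁
  let ustar : N := bestSingleton f
  let ρmin := α * f {ustar} / B
  let ρmax := n ^ 2 * (α * f {ustar}) / (ε * B)
  let K := ⌈Real.logb (1 - ε) ε⌉₊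
  (usm N₂).bind fun S =>
    bestOverThresholds f (fun ρ => probe f c B usm ρ N₁ N₂ ε) K (thresholds ε ρmin ρmax)
      (better f S {ustar})

end KnapsackSubmodular

end

/-! Why the ratio is 1/8. Let `O` be optimal, split into its expensive part `O₁` (inside `N₁`) and
its cheap part `O₂`, and let `o` be the costliest element of `O₁`. If `O₁` has at most one element,
`USM(N₂)` and the best singleton already suffice. Otherwise `B - c(o)` exceeds `εB/n`, and if the
value found is still below `OPT/8`, some threshold `ρ` of the geometric grid satisfies `(1-ε) OPT ≤
4ρ(B - c(o)) ≤ OPT`. Only this `ρ` matters.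

Two facts about `RandBatch` carry the proof. In expectation its output `A` has `f(A) ≥ (1-ε)² ρ
c(A)`: until a stopping condition holds, a uniformly random fitting element has at least this
density on average, so `f - (1-ε)² ρ c` is a submartingale along the stopped sequence
(`le_mean_getSeq_stopped`, `le_mean_randBatch`). Surely, the dense fitting elements left outside `A`
have total marginal gain at most `ε OPT` (`randBatch_support`): an increase of `count` without this
guarantee adds more than `ε² OPT` to a quantity, `waste`, that never exceeds `OPT`, so it cannot
happen `⌈ε⁻²⌉` times.

Call a run of `Probe` lucky if `A₁` and `A₂` both cost at most `min (B - c(o)) ((1-ε)B)`. Then every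
element of `O₁` fits into both sets, and `N₂ ∪ A₁` is feasible. With `X` the conditional expected
value of `Probe`, submodularity bounds `f(O₁ \ A₁)` by `2X + 2ρ(B - c(o)) + 2ε OPT`, while `USM`
gives `f((O₁ ∩ A₁) ∪ O₂) ≤ (2+ε)X`. Adding these and using `4ρ(B - c(o)) ≤ OPT` gives `(4+ε)X ≥ (1/2
- 2ε) OPT`.

If luck has probability at least `ε`, the repetitions fail to produce it with probability at most
`ε`. If not, `c(A₁) + c(A₂)` is almost `B - c(o)` in expectation, so the density bound makes `f(A₁)
+ f(A₂)` almost `OPT/4` in expectation, and the better of the two sets is worth almost `OPT/8`. -/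

namespace KnapsackSubmodular

universe u

set_option linter.unusedSectionVars false

open scoped ENNReal

/-- The expectation of an extended nonnegative function under a discrete law. -/
noncomputable def mean {α : Type*} (P : PMF α) (g : α → ℝ≥0∞) : ℝ≥0∞ := ∑' a, P a * g a

/-! ### Expectations in `ℝ≥0∞`, usable on the infinite type of lists without summability conditions.
-/

section Mean

variable {α β : Type*}

theorem mean_pure (a : α) (g : α → ℝ≥0∞) : mean (PMF.pure a) g = g a := by
  unfold mean
  rw [tsum_eq_single a]
  · simp
  · intro b hb
    simp [PMF.pure_apply, hb]

theorem mean_bind (P : PMF α) (Q : α → PMF β) (g : β → ℝ≥0∞) :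
    mean (P.bind Q) g = mean P fun a => mean (Q a) g := by
  unfold mean
  simp_rw [PMF.bind_apply, ← ENNReal.tsum_mul_right, ← ENNReal.tsum_mul_left]
  rw [ENNReal.tsum_comm]
  simp_rw [mul_assoc]

theorem mean_map (P : PMF α) (h : α → β) (g : β → ℝ≥0∞) :
    mean (P.map h) g = mean P fun a => g (h a) := by
  rw [PMF.map, mean_bind]
  simp [mean_pure]

theorem mean_mono {P : PMF α} {g h : α → ℝ≥0∞} (H : ∀ a ∈ P.support, g a ≤ h a) :
    mean P g ≤ mean P h := by
  refine ENNReal.tsum_le_tsum fun a => ?_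
  by_cases ha : a ∈ P.support
  · exact mul_le_mul_right (H a ha) _
  · rw [PMF.mem_support_iff, not_not] at ha
    simp [ha]

theorem mean_const (P : PMF α) (x : ℝ≥0∞) : mean P (fun _ => x) = x := by
  unfold mean
  rw [ENNReal.tsum_mul_right, P.tsum_coe, one_mul]

theorem le_mean {P : PMF α} {x : ℝ≥0∞} {g : α → ℝ≥0∞} (H : ∀ a ∈ P.support, x ≤ g a) :
    x ≤ mean P g := by
  rw [← mean_const P x]
  exact mean_mono H

theorem mean_ofReal [Fintype α] (P : PMF α) {g : α → ℝ} (hg : ∀ a, 0 ≤ g a) :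
    mean P (fun a => ENNReal.ofReal (g a)) = ENNReal.ofReal (∑ a, (P a).toReal * g a) := by
  unfold mean
  rw [tsum_fintype, ENNReal.ofReal_sum_of_nonneg]
  · refine Finset.sum_congr rfl fun a _ => ?_
    rw [ENNReal.ofReal_mul ENNReal.toReal_nonneg, ENNReal.ofReal_toReal (P.apply_ne_top a)]
  · intro a _
    exact mul_nonneg ENNReal.toReal_nonneg (hg a)

theorem sum_toReal_eq_one [Fintype α] (P : PMF α) : ∑ a, (P a).toReal = 1 := by
  rw [← ENNReal.toReal_sum fun a _ => P.apply_ne_top a, ← tsum_fintype (L := .unconditional _), P.tsum_coe]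
  simp

end Mean

/-! ### Random orderings, revealed one element at a time. -/

section RandPerm

variable {N : Type u} [Fintype N] [DecidableEq N]

theorem randPerm_apply (I : Finset N) (l : List N) :
    randPerm I l = if l.Nodup ∧ l.toFinset = I then ((I.card.factorial : ℝ≥0∞))⁻¹ else 0 := by
  unfold randPerm
  rw [PMF.map_apply]
  have hcard : Fintype.card (Fin I.card ≃ I) = I.card.factorial := by
    rw [Fintype.card_equiv I.equivFin.symm]; simp
  have hinj : Function.Injective
      (fun σ : Fin I.card ≃ I => List.ofFn fun i => (σ i : N)) := by
    intro σ τ h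
    have h' := List.ofFn_injective h
    ext i
    exact congrFun h' i
  split_ifs with h
  · obtain ⟨hn, rfl⟩ := h
    have hlen : l.toFinset.card = l.length := List.toFinset_card_of_nodup hn
    let e : Fin l.length ≃ {x // x ∈ l} := hn.getEquiv l
    let σ : Fin l.toFinset.card ≃ l.toFinset :=
      (finCongr hlen).trans (e.trans (Equiv.subtypeEquivRight (by simp)))
    have hσ : l = List.ofFn fun i => (σ i : N) := by
      apply List.ext_getElem
      · simp [hlen]
      · intro i h1 h2
        simp [σ, e]
    rw [tsum_eq_single σ]
    · rw [if_pos hσ]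
      have : Nonempty (Fin l.toFinset.card ≃ l.toFinset) := ⟨σ⟩
      rw [PMF.uniformOfFintype_apply, hcard]
    · intro τ hτ
      rw [if_neg]
      intro h
      exact hτ (hinj (h.symm.trans hσ))
  · rw [ENNReal.tsum_eq_zero]
    intro σ
    rw [if_neg]
    rintro rfl
    refine h ⟨?_, ?_⟩
    · rw [List.nodup_ofFn]
      exact Subtype.val_injective.comp σ.injective
    · ext x
      simp only [List.mem_toFinset, List.mem_ofFn]
      constructor
      · rintro ⟨i, rfl⟩
        exact (σ i).2
      · intro hx
        exact ⟨σ.symm ⟨x, hx⟩, by simp⟩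

theorem mem_support_randPerm {I : Finset N} {l : List N} :
    l ∈ (randPerm I).support ↔ l.Nodup ∧ l.toFinset = I := by
  rw [PMF.mem_support_iff, randPerm_apply]
  split_ifs with h
  · simp [h]
  · simp [h]

theorem randPerm_empty : randPerm (∅ : Finset N) = PMF.pure [] := by
  ext l
  rw [randPerm_apply, PMF.pure_apply]
  by_cases h : l = []
  · simp [h]
  · rw [if_neg, if_neg h]
    rintro ⟨-, h2⟩
    exact h (List.toFinset_eq_empty_iff _ |>.1 h2)

/-- A uniformly random ordering consists of a uniformly random first element followed by a
uniformly random ordering of the others. -/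
theorem randPerm_eq_bind {I : Finset N} (hI : I.Nonempty) :
    randPerm I = (PMF.uniformOfFinset I hI).bind fun a => (randPerm (I.erase a)).map (a :: ·) := by
  ext l
  rw [randPerm_apply, PMF.bind_apply]
  have hmap : ∀ a, ((randPerm (I.erase a)).map (a :: ·)) l =
      match l with
      | [] => 0
      | b :: t => if a = b then randPerm (I.erase a) t else 0 := by
    intro a
    rw [PMF.map_apply]
    cases l with
    | nil => simp
    | cons b t =>
      by_cases hab : a = b
      · subst hab
        rw [tsum_eq_single t]
        · simp
        · intro t' ht'
          simp [Ne.symm ht']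
      · simp [hab, Ne.symm hab]
  simp_rw [hmap]
  cases l with
  | nil =>
    rw [if_neg]
    · simp
    · rintro ⟨-, h⟩
      exact hI.ne_empty (by simpa using h.symm)
  | cons b t =>
    rw [tsum_eq_single b]
    · simp only [if_true, PMF.uniformOfFinset_apply, randPerm_apply]
      by_cases hb : b ∈ I
      · have hcond : ((b :: t).Nodup ∧ (b :: t).toFinset = I) ↔
            (t.Nodup ∧ t.toFinset = I.erase b) := by
          rw [List.nodup_cons, List.toFinset_cons]
          constructor
          · rintro ⟨⟨h1, h2⟩, rfl⟩
            refine ⟨h2, ?_⟩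
            rw [Finset.erase_insert (by simpa using h1)]
          · rintro ⟨h1, h2⟩
            refine ⟨⟨?_, h1⟩, ?_⟩
            · intro hbt
              have : b ∈ I.erase b := h2 ▸ List.mem_toFinset.2 hbt
              simp at this
            · rw [h2, Finset.insert_erase hb]
        simp only [hcond, if_pos hb]
        split_ifs with h
        · rw [Finset.card_erase_of_mem hb]
          have hpos : 0 < I.card := hI.card_pos
          rw [← Nat.mul_factorial_pred hpos.ne', Nat.cast_mul, ENNReal.mul_inv]
          · left; exact_mod_cast hpos.ne'
          · left; simp
        · simp
      · rw [if_neg, if_neg hb, zero_mul]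
        rintro ⟨-, h⟩
        exact hb (h ▸ by simp)
    · intro a ha
      simp [ha]

theorem mean_uniformOfFinset {I : Finset N} (hI : I.Nonempty) (g : N → ℝ≥0∞) :
    mean (PMF.uniformOfFinset I hI) g = (I.card : ℝ≥0∞)⁻¹ * ∑ a ∈ I, g a := by
  unfold mean
  rw [tsum_fintype, Finset.mul_sum, ← Finset.sum_filter_add_sum_filter_not _ (· ∈ I)]
  rw [Finset.sum_eq_zero (s := Finset.univ.filter (· ∉ I)), add_zero]
  · refine Finset.sum_congr (by ext; simp) fun a ha => ?_
    simp [PMF.uniformOfFinset_apply, ha]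
  · intro a ha
    simp [PMF.uniformOfFinset_apply, (Finset.mem_filter.1 ha).2]

theorem mean_randPerm {I : Finset N} (hI : I.Nonempty) (g : List N → ℝ≥0∞) :
    mean (randPerm I) g =
      (I.card : ℝ≥0∞)⁻¹ * ∑ a ∈ I, mean (randPerm (I.erase a)) fun l => g (a :: l) := by
  rw [randPerm_eq_bind hI, mean_bind, mean_uniformOfFinset]
  simp_rw [mean_map]

end RandPerm

/-! ### `GetSEQ` as a process appending uniformly random fitting elements. -/

section GetSeq

variable {N : Type u} [Fintype N] [DecidableEq N] {c : N → ℝ} {B : ℝ}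

theorem cost_mono (hc : ∀ u, 0 < c u) {X Y : Finset N} (h : X ⊆ Y) : cost c X ≤ cost c Y :=
  Finset.sum_le_sum_of_subset_of_nonneg h fun u _ _ => (hc u).le

theorem Feasible.mono (hc : ∀ u, 0 < c u) {X Y : Finset N} (h : X ⊆ Y) (hY : Feasible c B Y) :
    Feasible c B X :=
  (cost_mono hc h).trans hY

/-- The elements of `L` outside the sequence `V` that still fit into `A ∪ V`. -/
noncomputable def fitting (c : N → ℝ) (B : ℝ) (A L : Finset N) (V : List N) : Finset N :=
  open Classical in
  L.filter fun u => u ∉ V ∧ Feasible c B (insert u (A ∪ V.toFinset))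

theorem mem_fitting {A L : Finset N} {V : List N} {u : N} :
    u ∈ fitting c B A L V ↔ u ∈ L ∧ u ∉ V ∧ Feasible c B (insert u (A ∪ V.toFinset)) := by
  simp [fitting]

/-- The length of the longest prefix of `l` that fits into `A ∪ V`. -/
noncomputable def fitLength (c : N → ℝ) (B : ℝ) (A : Finset N) (V l : List N) : ℕ :=
  open Classical in
  Nat.findGreatest (fun i => Feasible c B (A ∪ V.toFinset ∪ (l.take i).toFinset)) l.length

theorem fitLength_eq_iff {A : Finset N} {V l : List N} {m : ℕ} :
    fitLength c B A V l = m ↔ m ≤ l.length ∧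
      (m ≠ 0 → Feasible c B (A ∪ V.toFinset ∪ (l.take m).toFinset)) ∧
      ∀ n, m < n → n ≤ l.length → ¬ Feasible c B (A ∪ V.toFinset ∪ (l.take n).toFinset) := by
  classical
  unfold fitLength
  rw [Nat.findGreatest_eq_iff]

theorem feasible_take_fitLength {A : Finset N} {V : List N} (h : Feasible c B (A ∪ V.toFinset))
    (l : List N) : Feasible c B (A ∪ (V ++ l.take (fitLength c B A V l)).toFinset) := by
  rw [List.toFinset_append, ← Finset.union_assoc]
  by_cases h0 : fitLength c B A V l = 0
  · simpa [h0] using h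
  · exact (fitLength_eq_iff.1 rfl).2.1 h0

theorem fitLength_cons_of_feasible {A : Finset N} {V l : List N} {a : N}
    (h : Feasible c B (insert a (A ∪ V.toFinset))) :
    fitLength c B A V (a :: l) = fitLength c B A (V ++ [a]) l + 1 := by
  have hset : ∀ i, A ∪ V.toFinset ∪ ((a :: l).take (i + 1)).toFinset =
      A ∪ (V ++ [a]).toFinset ∪ (l.take i).toFinset := by
    intro i
    ext x
    simp only [List.take_succ_cons, List.toFinset_cons, List.toFinset_append, Finset.mem_union,
      Finset.mem_insert, List.mem_toFinset, List.toFinset_nil, Finset.notMem_empty]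
    tauto
  have h0 : Feasible c B (A ∪ (V ++ [a]).toFinset) := by
    convert h using 1
    ext x
    simp only [List.toFinset_append, List.toFinset_cons, List.toFinset_nil, Finset.mem_union,
      Finset.mem_insert, Finset.notMem_empty]
    tauto
  obtain ⟨h1, -, h3⟩ := (fitLength_eq_iff (c := c) (B := B) (A := A) (V := V ++ [a]) (l := l)).1 rfl
  rw [fitLength_eq_iff]
  refine ⟨by simpa using h1, fun _ => ?_, ?_⟩
  · rw [hset, Finset.union_assoc, ← List.toFinset_append]
    exact feasible_take_fitLength h0 l
  · intro n hn hn'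
    obtain ⟨m, rfl⟩ : ∃ m, n = m + 1 := ⟨n - 1, by omega⟩
    rw [hset]
    exact h3 m (by omega) (by simpa using hn')

theorem fitLength_cons_of_not_feasible (hc : ∀ u, 0 < c u) {A : Finset N} {V l : List N} {a : N}
    (h : ¬ Feasible c B (insert a (A ∪ V.toFinset))) :
    fitLength c B A V (a :: l) = 0 := by
  rw [fitLength_eq_iff]
  refine ⟨Nat.zero_le _, by simp, fun n hn _ hP => h (hP.mono hc ?_)⟩
  obtain ⟨m, rfl⟩ : ∃ m, n = m + 1 := ⟨n - 1, by omega⟩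
  intro x
  simp
  tauto

theorem fitting_append_subset (hc : ∀ u, 0 < c u) (A L : Finset N) (V W : List N) :
    fitting c B A L (V ++ W) ⊆ fitting c B A L V := by
  intro x hx
  rw [mem_fitting] at hx ⊢
  refine ⟨hx.1, fun h => hx.2.1 (List.mem_append_left _ h), hx.2.2.mono hc ?_⟩
  intro y
  simp
  tauto

/-- Reveal the ordering of `J` element by element. A first element that does not fit ends the round
and leaves `V` unchanged. A first element that fits is uniform among the fitting ones, so the
hypothesis on `Ψ` applies, and the rest is a uniform ordering of `J.erase a`. The induction needs
`J` to be larger than the fitting set, since revealed elements can make others stop fitting. -/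
theorem le_mean_randPerm_fit (hc : ∀ u, 0 < c u) {A L : Finset N} {Ψ : List N → ℝ≥0∞}
    (hΨ : ∀ V, ((fitting c B A L V).card : ℝ≥0∞) * Ψ V ≤
      ∑ a ∈ fitting c B A L V, Ψ (V ++ [a])) (J : Finset N) :
    ∀ V : List N, J ⊆ L → (∀ a ∈ J, a ∉ V) → fitting c B A L V ⊆ J →
      Ψ V ≤ mean (randPerm J) fun l => Ψ (V ++ l.take (fitLength c B A V l)) := by
  induction hn : J.card generalizing J with
  | zero =>
    intro V _ _ _
    obtain rfl := Finset.card_eq_zero.1 hn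
    simp [randPerm_empty, mean_pure]
  | succ n ih =>
    intro V hJL hJV hfit
    have hJ : J.Nonempty := Finset.card_pos.1 (by omega)
    have hstep : ∀ a ∈ fitting c B A L V, Ψ (V ++ [a]) ≤ mean (randPerm (J.erase a)) fun l =>
        Ψ (V ++ (a :: l).take (fitLength c B A V (a :: l))) := by
      intro a ha
      have haf := (mem_fitting.1 ha).2.2
      refine (ih (J.erase a) (by rw [Finset.card_erase_of_mem (hfit ha)]; omega) (V ++ [a])
        ((Finset.erase_subset _ _).trans hJL) ?_ ?_).trans (le_of_eq ?_)
      · intro b hb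
        have := Finset.mem_erase.1 hb
        simp [this.1, hJV b this.2]
      · intro b hb
        refine Finset.mem_erase.2 ⟨?_, hfit (fitting_append_subset hc _ _ _ _ hb)⟩
        rintro rfl
        exact (mem_fitting.1 hb).2.1 (by simp)
      · congr 1
        ext l
        rw [fitLength_cons_of_feasible haf]
        simp
    have hskip : ∀ a ∈ J \ fitting c B A L V, Ψ V ≤ mean (randPerm (J.erase a)) fun l =>
        Ψ (V ++ (a :: l).take (fitLength c B A V (a :: l))) := by
      intro a ha
      rw [Finset.mem_sdiff] at ha
      have hna : ¬ Feasible c B (insert a (A ∪ V.toFinset)) := fun h =>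
        ha.2 (mem_fitting.2 ⟨hJL ha.1, hJV a ha.1, h⟩)
      refine le_mean fun l _ => ?_
      rw [fitLength_cons_of_not_feasible hc hna]
      simp
    rw [mean_randPerm hJ]
    have hcard0 : (J.card : ℝ≥0∞) ≠ 0 := by
      rw [hn]; simp
    calc Ψ V = (J.card : ℝ≥0∞)⁻¹ * (J.card * Ψ V) := by
          rw [← mul_assoc, ENNReal.inv_mul_cancel hcard0 (by simp), one_mul]
      _ ≤ _ := by
          refine mul_le_mul_right ?_ _
          rw [← Finset.sum_sdiff hfit, ← Finset.card_sdiff_add_card_eq_card hfit]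
          push_cast
          rw [add_mul]
          refine add_le_add ?_ ((hΨ V).trans (Finset.sum_le_sum hstep))
          rw [← nsmul_eq_mul]
          exact Finset.card_nsmul_le_sum _ _ _ hskip

/-- Fitting sets shrink as `V` grows, so filtering the current set is the same as filtering `L`
afresh: the loop variable `I` is always a function of `V`. -/
theorem getSeqLoop_succ (A L : Finset N) (hc : ∀ u, 0 < c u) (k : ℕ) (V : List N) :
    getSeqLoop c B A (k + 1) V (fitting c B A L V) =
      if fitting c B A L V = ∅ then PMF.pure V else
      (randPerm (fitting c B A L V)).bind fun l =>
        getSeqLoop c B A k (V ++ l.take (fitLength c B A V l))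
          (fitting c B A L (V ++ l.take (fitLength c B A V l))) := by
  classical
  rw [getSeqLoop]
  congr 1
  congr 1
  ext l : 1
  simp only
  congr 1
  have hs := fitting_append_subset (B := B) hc A L V (l.take (fitLength c B A V l))
  ext u
  rw [mem_fitting, Finset.mem_filter]
  constructor
  · rintro ⟨h1, h2⟩
    exact ⟨(mem_fitting.1 h1).1, h2⟩
  · intro h
    exact ⟨hs (mem_fitting.2 h), h.2⟩

theorem le_mean_getSeqLoop (hc : ∀ u, 0 < c u) {A L : Finset N} {Ψ : List N → ℝ≥0∞}
    (hΨ : ∀ V, ((fitting c B A L V).card : ℝ≥0∞) * Ψ V ≤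
      ∑ a ∈ fitting c B A L V, Ψ (V ++ [a])) (k : ℕ) (V : List N) :
    Ψ V ≤ mean (getSeqLoop c B A k V (fitting c B A L V)) Ψ := by
  induction k generalizing V with
  | zero => simp [getSeqLoop, mean_pure]
  | succ k ih =>
    rw [getSeqLoop_succ A L hc]
    split_ifs with h
    · rw [mean_pure]
    · rw [mean_bind]
      refine (le_mean_randPerm_fit hc hΨ (fitting c B A L V) V (fun x hx => (mem_fitting.1 hx).1)
        (fun x hx => (mem_fitting.1 hx).2.1) subset_rfl).trans (mean_mono fun l _ => ih _)

theorem getSeqLoop_support (hc : ∀ u, 0 < c u) {A L : Finset N} (k : ℕ) (V : List N)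
    (hk : (fitting c B A L V).card ≤ k) (hV : V.Nodup) (hVL : ∀ a ∈ V, a ∈ L)
    (hf : Feasible c B (A ∪ V.toFinset)) {v : List N}
    (hv : v ∈ (getSeqLoop c B A k V (fitting c B A L V)).support) :
    v.Nodup ∧ (∀ a ∈ v, a ∈ L) ∧ Feasible c B (A ∪ v.toFinset) ∧ fitting c B A L v = ∅ := by
  induction k generalizing V with
  | zero =>
    simp only [getSeqLoop, PMF.support_pure, Set.mem_singleton_iff] at hv
    subst hv
    exact ⟨hV, hVL, hf, Finset.card_eq_zero.1 (by omega)⟩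
  | succ k ih =>
    rw [getSeqLoop_succ A L hc] at hv
    split_ifs at hv with h
    · simp only [PMF.support_pure, Set.mem_singleton_iff] at hv
      subst hv
      exact ⟨hV, hVL, hf, h⟩
    · rw [PMF.mem_support_bind_iff] at hv
      obtain ⟨l, hl, hv⟩ := hv
      obtain ⟨hl1, hl2⟩ := mem_support_randPerm.1 hl
      have hlmem : ∀ a ∈ l, a ∈ fitting c B A L V := fun a ha => hl2 ▸ List.mem_toFinset.2 ha
      refine ih _ ?_ ?_ ?_ (feasible_take_fitLength hf l) hv
      -- The first element of the ordering fits by itself, hence is taken, and the fitting set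
      -- strictly shrinks; this is why `|I|` rounds suffice.
      · obtain ⟨a, t, rfl⟩ : ∃ a t, l = a :: t := by
          cases l with
          | nil => exact absurd hl2.symm h
          | cons a t => exact ⟨a, t, rfl⟩
        have ha := hlmem a (by simp)
        have hlt : fitting c B A L (V ++ (a :: t).take (fitLength c B A V (a :: t))) ⊂
            fitting c B A L V := by
          refine Finset.ssubset_iff_subset_ne.2 ⟨fitting_append_subset hc _ _ _ _, fun he => ?_⟩
          have hfa := (mem_fitting.1 ha).2.2
          rw [← he, mem_fitting, fitLength_cons_of_feasible hfa] at ha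
          exact ha.2.1 (by simp)
        have := Finset.card_lt_card hlt
        omega
      · refine hV.append (hl1.sublist (List.take_sublist _ _)) ?_
        intro a ha ha'
        exact (mem_fitting.1 (hlmem a (List.mem_of_mem_take ha'))).2.1 ha
      · intro a ha
        rcases List.mem_append.1 ha with ha | ha
        · exact hVL a ha
        · exact (mem_fitting.1 (hlmem a (List.mem_of_mem_take ha))).1

theorem fitting_nil {A L : Finset N} (hL : ∀ a ∈ L, Feasible c B (insert a A)) :
    fitting c B A L [] = L := by
  ext a
  rw [mem_fitting]
  simp
  exact hL a

/-- If `Ψ` does not decrease on average when a uniformly random fitting element is appended, then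
it does not decrease on average along `GetSEQ`. -/
theorem le_mean_getSeq (hc : ∀ u, 0 < c u) {A L : Finset N}
    (hL : ∀ a ∈ L, Feasible c B (insert a A)) {Ψ : List N → ℝ≥0∞}
    (hΨ : ∀ V, ((fitting c B A L V).card : ℝ≥0∞) * Ψ V ≤
      ∑ a ∈ fitting c B A L V, Ψ (V ++ [a])) :
    Ψ [] ≤ mean (getSeq c B A L) Ψ := by
  have := le_mean_getSeqLoop hc hΨ L.card []
  rwa [fitting_nil hL] at this

theorem getSeq_support (hc : ∀ u, 0 < c u) {A L : Finset N}
    (hL : ∀ a ∈ L, Feasible c B (insert a A)) (hA : Feasible c B A) {v : List N}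
    (hv : v ∈ (getSeq c B A L).support) :
    v.Nodup ∧ (∀ a ∈ v, a ∈ L) ∧ Feasible c B (A ∪ v.toFinset) ∧ fitting c B A L v = ∅ := by
  refine getSeqLoop_support hc L.card [] ?_ List.nodup_nil (by simp) (by simpa using hA) ?_
  · rw [fitting_nil hL]
  · rwa [fitting_nil hL]

end GetSeq

/-! ### Submodular inequalities and the loss along a sequence. -/

section SubmodularFacts

variable {N : Type u} [Fintype N] [DecidableEq N] {f : Finset N → ℝ} {c : N → ℝ} {B : ℝ}

theorem marginal_of_mem {u : N} {X : Finset N} (h : u ∈ X) : marginal f u X = 0 := by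
  simp [marginal, h]

/-- Diminishing returns. -/
theorem Submodular.marginal_anti (hf : Submodular f) {X Y : Finset N} (h : X ⊆ Y) {u : N}
    (hu : u ∉ Y) : marginal f u Y ≤ marginal f u X := by
  have h1 := hf (insert u X) Y
  have h2 : insert u X ∪ Y = insert u Y := by
    rw [Finset.insert_union, Finset.union_eq_right.2 h]
  have h3 : insert u X ∩ Y = X := by
    rw [Finset.insert_inter_of_notMem hu, Finset.inter_eq_left.2 h]
  rw [h2, h3] at h1
  unfold marginal
  linarith

theorem Submodular.union_le (hf : Submodular f) (A W : Finset N) :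
    f (A ∪ W) ≤ f A + ∑ u ∈ W, marginal f u A := by
  induction W using Finset.induction_on with
  | empty => simp
  | insert a W ha ih =>
    rw [Finset.sum_insert ha, Finset.union_insert]
    by_cases h : a ∈ A ∪ W
    · rw [Finset.insert_eq_of_mem h]
      have : a ∈ A := (Finset.mem_union.1 h).resolve_right ha
      rw [marginal_of_mem this]
      linarith
    · have := hf.marginal_anti (Finset.subset_union_left (s₁ := A) (s₂ := W)) h
      unfold marginal at this ⊢
      unfold marginal at ih
      linarith

theorem le_OPT {X : Finset N} (h : Feasible c B X) : f X ≤ OPT f c B :=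
  le_csSup (Set.toFinite _).bddAbove ⟨X, h, rfl⟩

theorem exists_eq_OPT (hB : 0 < B) : ∃ X, Feasible c B X ∧ f X = OPT f c B := by
  have : (f '' {X | Feasible c B X}).Nonempty :=
    ⟨f ∅, ∅, by simp [Feasible, cost, hB.le], rfl⟩
  exact this.csSup_mem (Set.toFinite _)

/-- The total absolute value of the negative marginal gains met when the elements of a list are
added to `A` one by one. -/
noncomputable def listLoss (f : Finset N → ℝ) : Finset N → List N → ℝ
  | _, [] => 0
  | A, a :: t => (if marginal f a A < 0 then |marginal f a A| else 0) + listLoss f (insert a A) t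

theorem listLoss_nonneg (A : Finset N) (l : List N) : 0 ≤ listLoss f A l := by
  induction l generalizing A with
  | nil => simp [listLoss]
  | cons a t ih =>
    rw [listLoss]
    have := ih (insert a A)
    split_ifs
    · positivity
    · linarith

theorem prefixSet_cons (A : Finset N) (a : N) (t : List N) (i : ℕ) :
    prefixSet A (a :: t) (i + 1) = prefixSet (insert a A) t i := by
  simp [prefixSet]

theorem prefixLoss_eq_listLoss (A : Finset N) (v : List N) (i : ℕ) :
    prefixLoss f A v i = listLoss f A (v.take i) := by
  unfold prefixLoss
  rw [Finset.sum_filter]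
  induction v generalizing A i with
  | nil => simp [listLoss]
  | cons a t ih =>
    cases i with
    | zero => simp [listLoss]
    | succ i =>
      rw [List.take_succ_cons, listLoss, ← ih]
      refine (Fin.sum_univ_succ (n := t.length) _).trans ?_
      congr 1
      · simp [prefixSet]
      · refine Finset.sum_congr rfl fun j _ => ?_
        simp [prefixSet_cons]

/-- Dropping the elements whose addition decreased `f` increases the value by the loss. -/
theorem Submodular.exists_add_listLoss_le (hf : Submodular f) (w : List N) :
    ∀ A D : Finset N, D ⊆ A → w.Nodup → (∀ a ∈ w, a ∉ A) →
      ∃ D' ⊆ A ∪ w.toFinset,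
        f (A \ D) - f A + listLoss f A w ≤ f ((A ∪ w.toFinset) \ D') - f (A ∪ w.toFinset) := by
  induction w with
  | nil =>
    intro A D hD _ _
    exact ⟨D, by simpa using hD, by simp [listLoss]⟩
  | cons a t ih =>
    intro A D hD hw hA
    rw [List.nodup_cons] at hw
    have haA : a ∉ A := hA a (by simp)
    have htA : ∀ b ∈ t, b ∉ insert a A := by
      intro b hb h
      rcases Finset.mem_insert.1 h with rfl | h
      · exact hw.1 hb
      · exact hA b (by simp [hb]) h
    have hset : A ∪ (a :: t).toFinset = insert a A ∪ t.toFinset := by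
      simp
    rw [hset, listLoss]
    -- An element of negative gain joins `D`, which raises the difference by exactly its loss. Any
    -- other element stays out of `D`, and by diminishing returns its gain over `A \ D` is at least
    -- its gain over `A`.
    split_ifs with hneg
    · obtain ⟨D', hD', h⟩ := ih (insert a A) (insert a D) (Finset.insert_subset_insert _ hD) hw.2 htA
      refine ⟨D', hD', le_trans ?_ h⟩
      have : insert a A \ insert a D = A \ D := by
        ext x
        simp only [Finset.mem_sdiff, Finset.mem_insert]
        constructor
        · tauto
        · rintro ⟨h1, h2⟩
          refine ⟨Or.inr h1, ?_⟩
          rintro (rfl | h3)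
          · exact haA h1
          · exact h2 h3
      rw [this, abs_of_neg hneg]
      unfold marginal
      linarith
    · obtain ⟨D', hD', h⟩ := ih (insert a A) D (hD.trans (Finset.subset_insert _ _)) hw.2 htA
      refine ⟨D', hD', le_trans ?_ h⟩
      have haD : a ∉ D := fun h => haA (hD h)
      rw [Finset.insert_sdiff_of_notMem _ haD]
      have := hf.marginal_anti (Finset.sdiff_subset (s := A) (t := D)) haA
      unfold marginal at this
      linarith

end SubmodularFacts

/-! ### Stopping times on prefixes. -/

section StopTime

variable {N : Type u}

theorem exists_stop (S : List N → Prop) (V : List N) : ∃ i, V.length ≤ i ∨ S (V.take i) :=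
  ⟨V.length, Or.inl le_rfl⟩

/-- The length of the shortest prefix of `V` with property `S`, or of `V` itself if there is no
such prefix. -/
noncomputable def stopTime (S : List N → Prop) (V : List N) : ℕ :=
  open Classical in Nat.find (exists_stop S V)

theorem stopTime_eq_iff {S : List N → Prop} {V : List N} {m : ℕ} :
    stopTime S V = m ↔ (V.length ≤ m ∨ S (V.take m)) ∧ ∀ i < m, i < V.length ∧ ¬ S (V.take i) := by
  classical
  unfold stopTime
  rw [Nat.find_eq_iff]
  simp only [not_or, not_le]

/-- Once some prefix has met the rule, the stopped sequence is frozen. With the complementary case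
`take_stopTime_append_of_not_exists`, this allows one-step averaging of a stopped process. -/
theorem take_stopTime_append_of_exists {S : List N → Prop} {V : List N}
    (h : ∃ i ≤ V.length, S (V.take i)) (a : N) :
    (V ++ [a]).take (stopTime S (V ++ [a])) = V.take (stopTime S V) := by
  obtain ⟨h1, h2⟩ := (stopTime_eq_iff (S := S) (V := V)).1 rfl
  obtain ⟨i, hi, hS⟩ := h
  have hle : stopTime S V ≤ i := by
    by_contra hlt
    exact (h2 i (by omega)).2 hS
  have heq : stopTime S (V ++ [a]) = stopTime S V := by
    rw [stopTime_eq_iff]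
    refine ⟨Or.inr ?_, ?_⟩
    · rw [List.take_append_of_le_length (by omega)]
      rcases h1 with h1 | h1
      · obtain rfl : i = stopTime S V := by omega
        exact hS
      · exact h1
    · intro j hj
      rw [List.take_append_of_le_length (by omega)]
      refine ⟨?_, (h2 j hj).2⟩
      have := (h2 j hj).1
      simp
      omega
  rw [heq, List.take_append_of_le_length (by omega)]

theorem take_stopTime_of_not_exists {S : List N → Prop} {V : List N}
    (h : ∀ i < V.length, ¬ S (V.take i)) : V.take (stopTime S V) = V := by
  have : stopTime S V = V.length := by
    rw [stopTime_eq_iff]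
    exact ⟨Or.inl le_rfl, fun i hi => ⟨hi, h i hi⟩⟩
  rw [this, List.take_length]

theorem take_stopTime_append_of_not_exists {S : List N → Prop} {V : List N}
    (h : ¬ ∃ i ≤ V.length, S (V.take i)) (a : N) :
    (V ++ [a]).take (stopTime S (V ++ [a])) = V ++ [a] := by
  refine take_stopTime_of_not_exists fun i hi hS => h ⟨i, ?_, ?_⟩
  · simp at hi
    omega
  · rwa [List.take_append_of_le_length (by simp at hi; omega)] at hS

end StopTime

/-! ### The expected density of the output of `RandBatch`. -/

section Batch

variable {N : Type u} [Fintype N] [DecidableEq N] {f : Finset N → ℝ} {c : N → ℝ} {B ρ ε : ℝ}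

theorem mem_valuable (hc : ∀ u, 0 < c u) {I A : Finset N} {u : N} :
    u ∈ valuable f c B ρ I A ↔
      u ∈ I ∧ ρ * c u ≤ marginal f u A ∧ Feasible c B (insert u A) := by
  simp [valuable, le_div_iff₀ (hc u)]

theorem mem_harmful {L A : Finset N} {u : N} :
    u ∈ harmful f L A ↔ u ∈ L ∧ marginal f u A < 0 := by
  simp [harmful]

/-- The condition defining `t₁`, for the prefix `V`. -/
def CostStop (f : Finset N → ℝ) (c : N → ℝ) (B ρ ε : ℝ) (A L : Finset N) (V : List N) : Prop :=
  cost c (valuable f c B ρ L (A ∪ V.toFinset)) ≤ (1 - ε) * cost c L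

/-- The condition defining `t₂`, for the prefix `V`. -/
def LossStop (f : Finset N → ℝ) (c : N → ℝ) (B ρ ε : ℝ) (A L : Finset N) (V : List N) : Prop :=
  ε * ∑ u ∈ valuable f c B ρ L (A ∪ V.toFinset), marginal f u (A ∪ V.toFinset) ≤
    ∑ u ∈ harmful f L (A ∪ V.toFinset), |marginal f u (A ∪ V.toFinset)| + listLoss f A V

theorem t₁_eq (A L : Finset N) (v : List N) :
    t₁ f c B ρ ε A L v = sInf {i | i ≤ v.length ∧ CostStop f c B ρ ε A L (v.take i)} := rfl

theorem t₂_eq (A L : Finset N) (v : List N) :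
    t₂ f c B ρ ε A L v = sInf {i | i ≤ v.length ∧ LossStop f c B ρ ε A L (v.take i)} := by
  unfold t₂ LossStop
  simp only [prefixLoss_eq_listLoss]
  rfl

/-- An element already in `V` has marginal gain zero, which is below `ρ c(u) > 0`. -/
theorem valuable_subset_fitting (hc : ∀ u, 0 < c u) (hρ : 0 < ρ) (A L : Finset N) (V : List N) :
    valuable f c B ρ L (A ∪ V.toFinset) ⊆ fitting c B A L V := by
  intro u hu
  rw [mem_valuable hc] at hu
  refine mem_fitting.2 ⟨hu.1, fun huV => ?_, hu.2.2⟩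
  have h1 := hu.2.1
  rw [marginal_of_mem (by simp [huV])] at h1
  have := mul_pos hρ (hc u)
  linarith

/-- While the stopping rule is not met, a uniformly random fitting element has, on average,
marginal density at least `(1 - ε)² ρ`. -/
theorem sum_marginal_fitting_ge (hc : ∀ u, 0 < c u) (hρ : 0 < ρ) (hε1 : ε < 1)
    {A L : Finset N} {V : List N} (h1 : ¬ CostStop f c B ρ ε A L V)
    (h2 : ¬ LossStop f c B ρ ε A L V) :
    (1 - ε) ^ 2 * ρ * cost c (fitting c B A L V) ≤
      ∑ u ∈ fitting c B A L V, marginal f u (A ∪ V.toFinset) := by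
  have hsub := valuable_subset_fitting (f := f) (B := B) hc hρ A L V
  have hloss := listLoss_nonneg (f := f) A V
  unfold CostStop at h1
  unfold LossStop at h2
  push Not at h1 h2
  set G := A ∪ V.toFinset
  set E := valuable f c B ρ L G
  set F := fitting c B A L V
  have hFL : F ⊆ L := fun u hu => (mem_fitting.1 hu).1
  -- Fitting elements that are not valuable can reduce the sum only through those of negative gain,
  -- all of which are harmful.
  have hrest : -∑ u ∈ harmful f L G, |marginal f u G| ≤ ∑ u ∈ F \ E, marginal f u G := by
    have hle : ∑ u ∈ F \ E, -marginal f u G ≤ ∑ u ∈ harmful f L G, |marginal f u G| := by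
      calc ∑ u ∈ F \ E, -marginal f u G
          ≤ ∑ u ∈ F \ E, if marginal f u G < 0 then |marginal f u G| else 0 := by
            refine Finset.sum_le_sum fun u _ => ?_
            split_ifs with h
            · exact neg_le_abs _
            · linarith
        _ = ∑ u ∈ (F \ E).filter fun u => marginal f u G < 0, |marginal f u G| := by
            rw [Finset.sum_filter]
        _ ≤ _ := by
            refine Finset.sum_le_sum_of_subset_of_nonneg ?_ fun u _ _ => abs_nonneg _
            intro u hu
            rw [Finset.mem_filter, Finset.mem_sdiff] at hu
            exact mem_harmful.2 ⟨hFL hu.1.1, hu.2⟩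
    rw [Finset.sum_neg_distrib] at hle
    linarith
  have hE : ρ * cost c E ≤ ∑ u ∈ E, marginal f u G := by
    unfold cost
    rw [Finset.mul_sum]
    exact Finset.sum_le_sum fun u hu => ((mem_valuable hc).1 hu).2.1
  have hcF : cost c F ≤ cost c L := cost_mono hc hFL
  rw [← Finset.sum_sdiff hsub]
  have hε : 0 < 1 - ε := by linarith
  -- One factor `1 - ε` comes from the failure of `CostStop`, the other from the failure of
  -- `LossStop`.
  calc (1 - ε) ^ 2 * ρ * cost c F = (1 - ε) * (ρ * ((1 - ε) * cost c F)) := by ring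
    _ ≤ (1 - ε) * (ρ * ((1 - ε) * cost c L)) := by gcongr
    _ ≤ (1 - ε) * (ρ * cost c E) := by gcongr
    _ ≤ (1 - ε) * ∑ u ∈ E, marginal f u G := by gcongr
    _ ≤ _ := by linarith

/-- The potential `f(A) + κ c(N ∖ A)`. -/
noncomputable def potential (f : Finset N → ℝ) (c : N → ℝ) (κ : ℝ) (A : Finset N) : ℝ :=
  f A + κ * (cost c Finset.univ - cost c A)

/-- The constant `κ c(N)` is part of the potential for this purpose only: `f - κ c` may be negative,
and expectations over lists are taken in `ℝ≥0∞`. -/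
theorem potential_nonneg (hf0 : ∀ X, 0 ≤ f X) (hc : ∀ u, 0 < c u) {κ : ℝ} (hκ : 0 ≤ κ)
    (A : Finset N) : 0 ≤ potential f c κ A := by
  have h1 := cost_mono hc (Finset.subset_univ A)
  have h2 := mul_nonneg hκ (sub_nonneg.2 h1)
  have h3 := hf0 A
  unfold potential
  linarith

theorem cost_insert_le (hc : ∀ u, 0 < c u) (u : N) (A : Finset N) :
    cost c (insert u A) ≤ c u + cost c A := by
  by_cases h : u ∈ A
  · rw [Finset.insert_eq_of_mem h]
    linarith [hc u]
  · unfold cost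
    rw [Finset.sum_insert h]

/-- Optional stopping: the stopped potential is constant after the stopping time, and before it the
density bound `sum_marginal_fitting_ge` says exactly that one random step does not lower it on
average. -/
theorem le_mean_getSeq_stopped (hf0 : ∀ X, 0 ≤ f X) (hc : ∀ u, 0 < c u) (hρ : 0 < ρ)
    (hε1 : ε < 1) {A L : Finset N} (hL : ∀ a ∈ L, Feasible c B (insert a A)) :
    ENNReal.ofReal (potential f c ((1 - ε) ^ 2 * ρ) A) ≤ mean (getSeq c B A L) fun v =>
      ENNReal.ofReal (potential f c ((1 - ε) ^ 2 * ρ) (A ∪ (v.take (stopTime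
        (fun V => CostStop f c B ρ ε A L V ∨ LossStop f c B ρ ε A L V) v)).toFinset)) := by
  set S := fun V => CostStop f c B ρ ε A L V ∨ LossStop f c B ρ ε A L V
  have hκ : 0 ≤ (1 - ε) ^ 2 * ρ := by positivity
  set κ := (1 - ε) ^ 2 * ρ with hκdef
  have key := le_mean_getSeq hc hL
    (Ψ := fun v => ENNReal.ofReal (potential f c κ (A ∪ (v.take (stopTime S v)).toFinset))) ?_
  · simpa using key
  intro V
  by_cases h : ∃ i ≤ V.length, S (V.take i)
  · simp only [take_stopTime_append_of_exists h]
    rw [Finset.sum_const, nsmul_eq_mul]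
  · simp only [take_stopTime_append_of_not_exists h]
    rw [take_stopTime_of_not_exists fun i hi hS => h ⟨i, hi.le, hS⟩]
    have hS : ¬ S V := fun hS => h ⟨V.length, le_rfl, by simpa using hS⟩
    have hsum := sum_marginal_fitting_ge hc hρ hε1 (fun h => hS (Or.inl h))
      (fun h => hS (Or.inr h))
    rw [← ENNReal.ofReal_sum_of_nonneg fun u _ => potential_nonneg hf0 hc hκ _,
      ← ENNReal.ofReal_natCast, ← ENNReal.ofReal_mul (Nat.cast_nonneg _)]
    refine ENNReal.ofReal_le_ofReal ?_
    rw [← nsmul_eq_mul, ← Finset.sum_const, ← sub_nonneg, ← Finset.sum_sub_distrib]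
    rw [← sub_nonneg, cost, Finset.mul_sum, ← Finset.sum_sub_distrib] at hsum
    refine hsum.trans (Finset.sum_le_sum fun u _ => ?_)
    have hset : A ∪ (V ++ [u]).toFinset = insert u (A ∪ V.toFinset) := by
      ext x
      simp only [List.toFinset_append, List.toFinset_cons, List.toFinset_nil, Finset.mem_union,
        Finset.mem_insert, Finset.notMem_empty]
      tauto
    rw [hset]
    have := mul_le_mul_of_nonneg_left (cost_insert_le hc u (A ∪ V.toFinset)) hκ
    unfold potential marginal
    linarith

theorem coin_one : coin 1 le_rfl = PMF.pure true := by
  ext b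
  cases b <;> simp [coin, PMF.pure_apply]

/-- With `p = 1` every batch is accepted, so `U` and `A` grow by the same sets; started equal, they
stay equal. -/
theorem randBatchLoop_succ (M k : ℕ) (A U L : Finset N) (count : ℕ) :
    randBatchLoop f c B ρ M 1 le_rfl ε (k + 1) A U L count =
      if L = ∅ ∨ M ≤ count then PMF.pure (A, U, L) else
      (getSeq c B A L).bind fun v =>
        randBatchLoop f c B ρ M 1 le_rfl ε k
          (A ∪ (v.take (min (t₁ f c B ρ ε A L v) (t₂ f c B ρ ε A L v))).toFinset)
          (U ∪ (v.take (min (t₁ f c B ρ ε A L v) (t₂ f c B ρ ε A L v))).toFinset)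
          (valuable f c B ρ
            (L \ (U ∪ (v.take (min (t₁ f c B ρ ε A L v) (t₂ f c B ρ ε A L v))).toFinset))
            (A ∪ (v.take (min (t₁ f c B ρ ε A L v) (t₂ f c B ρ ε A L v))).toFinset))
          (if t₂ f c B ρ ε A L v < t₁ f c B ρ ε A L v then count + 1 else count) := by
  rw [randBatchLoop]
  simp only [coin_one, PMF.pure_bind, if_true, true_and]

/-- The part of the loop invariant of `RandBatch` that the choice of the batch depends on. -/
structure BatchState (f : Finset N → ℝ) (c : N → ℝ) (B ρ : ℝ) (A L : Finset N) : Prop where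
  feasible : Feasible c B A
  disjoint : Disjoint L A
  dense : ∀ u ∈ L, ρ * c u ≤ marginal f u A
  fits : ∀ u ∈ L, Feasible c B (insert u A)

/-- What is known about the batch that is cut out of the sequence `v` in one round. -/
structure BatchFacts (f : Finset N → ℝ) (c : N → ℝ) (B ρ ε : ℝ) (A L : Finset N) (v : List N) :
    Prop where
  min_eq : min (t₁ f c B ρ ε A L v) (t₂ f c B ρ ε A L v) = stopTime
    (fun V => CostStop f c B ρ ε A L V ∨ LossStop f c B ρ ε A L V) v
  nodup : (v.take (min (t₁ f c B ρ ε A L v) (t₂ f c B ρ ε A L v))).Nodup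
  subset : (v.take (min (t₁ f c B ρ ε A L v) (t₂ f c B ρ ε A L v))).toFinset ⊆ L
  nonempty : (v.take (min (t₁ f c B ρ ε A L v) (t₂ f c B ρ ε A L v))).toFinset.Nonempty
  feasible : Feasible c B
    (A ∪ (v.take (min (t₁ f c B ρ ε A L v) (t₂ f c B ρ ε A L v))).toFinset)
  lossStop : t₂ f c B ρ ε A L v < t₁ f c B ρ ε A L v →
    LossStop f c B ρ ε A L (v.take (min (t₁ f c B ρ ε A L v) (t₂ f c B ρ ε A L v)))

theorem cost_pos (hc : ∀ u, 0 < c u) {L : Finset N} (hL : L.Nonempty) : 0 < cost c L :=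
  Finset.sum_pos (fun u _ => hc u) hL

/-- Nothing in `L` fits after the whole sequence, so no element is valuable there and `i = d` meets
both conditions: neither infimum is over the empty set. At `i = 0` all of `L` is valuable and
nothing is harmful, so neither condition holds and the batch is nonempty. -/
theorem BatchState.batchFacts (hc : ∀ u, 0 < c u) (hρ : 0 < ρ) (hε0 : 0 < ε) (hε1 : ε < 1)
    {A L : Finset N} (h : BatchState f c B ρ A L) (hL : L ≠ ∅) {v : List N}
    (hv : v ∈ (getSeq c B A L).support) : BatchFacts f c B ρ ε A L v := by
  obtain ⟨hnd, hvL, hvf, hmax⟩ := getSeq_support hc h.fits h.feasible hv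
  have hval : valuable f c B ρ L (A ∪ v.toFinset) = ∅ :=
    Finset.subset_empty.1 (hmax ▸ valuable_subset_fitting hc hρ A L v)
  have hcL := cost_pos hc (Finset.nonempty_iff_ne_empty.2 hL)
  have hC : CostStop f c B ρ ε A L (v.take v.length) := by
    rw [List.take_length, CostStop, hval]
    simp only [cost, Finset.sum_empty]
    exact mul_nonneg (by linarith) hcL.le
  have hS : LossStop f c B ρ ε A L (v.take v.length) := by
    rw [List.take_length, LossStop, hval]
    simp only [Finset.sum_empty, mul_zero]
    exact add_nonneg (Finset.sum_nonneg fun u _ => abs_nonneg _) (listLoss_nonneg _ _)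
  have hvalL : valuable f c B ρ L A = L := by
    ext u
    rw [mem_valuable hc]
    exact ⟨fun h => h.1, fun hu => ⟨hu, h.dense u hu, h.fits u hu⟩⟩
  have hC0 : ¬ CostStop f c B ρ ε A L [] := by
    unfold CostStop
    simp only [List.toFinset_nil, Finset.union_empty, hvalL]
    nlinarith
  have hS0 : ¬ LossStop f c B ρ ε A L [] := by
    unfold LossStop
    simp only [List.toFinset_nil, Finset.union_empty, hvalL, listLoss]
    have hE : harmful f L A = ∅ := by
      rw [Finset.eq_empty_iff_forall_notMem]
      intro u hu
      rw [mem_harmful] at hu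
      have := h.dense u hu.1
      have := mul_pos hρ (hc u)
      linarith
    have hsum : ρ * cost c L ≤ ∑ u ∈ L, marginal f u A := by
      unfold cost
      rw [Finset.mul_sum]
      exact Finset.sum_le_sum h.dense
    have : 0 < ρ * cost c L := mul_pos hρ hcL
    rw [hE, Finset.sum_empty]
    have : 0 < ε * ∑ u ∈ L, marginal f u A := mul_pos hε0 (by linarith)
    linarith
  have ht1 : t₁ f c B ρ ε A L v ≤ v.length ∧
      CostStop f c B ρ ε A L (v.take (t₁ f c B ρ ε A L v)) := by
    rw [t₁_eq]
    exact Nat.sInf_mem (s := {i | i ≤ v.length ∧ CostStop f c B ρ ε A L (v.take i)})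
      ⟨v.length, le_rfl, hC⟩
  have ht2 : t₂ f c B ρ ε A L v ≤ v.length ∧
      LossStop f c B ρ ε A L (v.take (t₂ f c B ρ ε A L v)) := by
    rw [t₂_eq]
    exact Nat.sInf_mem (s := {i | i ≤ v.length ∧ LossStop f c B ρ ε A L (v.take i)})
      ⟨v.length, le_rfl, hS⟩
  have hn1 : ∀ i < t₁ f c B ρ ε A L v, ¬ CostStop f c B ρ ε A L (v.take i) := by
    intro i hi hi'
    have hle := ht1.1
    rw [t₁_eq] at hi
    rw [t₁_eq] at hle
    exact Nat.notMem_of_lt_sInf hi ⟨by omega, hi'⟩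
  have hn2 : ∀ i < t₂ f c B ρ ε A L v, ¬ LossStop f c B ρ ε A L (v.take i) := by
    intro i hi hi'
    have hle := ht2.1
    rw [t₂_eq] at hi
    rw [t₂_eq] at hle
    exact Nat.notMem_of_lt_sInf hi ⟨by omega, hi'⟩
  have hp1 : 0 < t₁ f c B ρ ε A L v := by
    rw [Nat.pos_iff_ne_zero]
    intro h0
    rw [h0] at ht1
    exact hC0 ht1.2
  have hp2 : 0 < t₂ f c B ρ ε A L v := by
    rw [Nat.pos_iff_ne_zero]
    intro h0
    rw [h0] at ht2
    exact hS0 ht2.2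
  refine ⟨?_, hnd.sublist (List.take_sublist _ _), ?_, ?_, ?_, ?_⟩
  · symm
    rw [stopTime_eq_iff]
    refine ⟨Or.inr ?_, fun i hi => ⟨by omega, ?_⟩⟩
    · rcases le_total (t₁ f c B ρ ε A L v) (t₂ f c B ρ ε A L v) with hle | hle
      · rw [min_eq_left hle]
        exact Or.inl ht1.2
      · rw [min_eq_right hle]
        exact Or.inr ht2.2
    · rintro (hs | hs)
      · exact hn1 i (by omega) hs
      · exact hn2 i (by omega) hs
  · intro u hu
    exact hvL u (List.mem_of_mem_take (List.mem_toFinset.1 hu))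
  · rw [List.toFinset_nonempty_iff]
    intro hnil
    rw [List.take_eq_nil_iff] at hnil
    rcases hnil with h0 | h0
    · omega
    · have := ht1.1
      rw [h0] at this hp1
      simp at this
      omega
  · refine hvf.mono hc (Finset.union_subset_union_right ?_)
    intro u hu
    exact List.mem_toFinset.2 (List.mem_of_mem_take (List.mem_toFinset.1 hu))
  · intro hlt
    rw [min_eq_right hlt.le]
    exact ht2.2

theorem BatchState.next (hc : ∀ u, 0 < c u) {A L V : Finset N}
    (hV : Feasible c B (A ∪ V)) :
    BatchState f c B ρ (A ∪ V) (valuable f c B ρ (L \ (A ∪ V)) (A ∪ V)) := by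
  refine ⟨hV, ?_, fun u hu => ((mem_valuable hc).1 hu).2.1, fun u hu => ((mem_valuable hc).1 hu).2.2⟩
  rw [Finset.disjoint_left]
  intro u hu
  exact (Finset.mem_sdiff.1 ((mem_valuable hc).1 hu).1).2

theorem le_mean_randBatchLoop (hf0 : ∀ X, 0 ≤ f X) (hc : ∀ u, 0 < c u) (hρ : 0 < ρ)
    (hε0 : 0 < ε) (hε1 : ε < 1) (M k : ℕ) (A L : Finset N) (count : ℕ)
    (h : BatchState f c B ρ A L) :
    ENNReal.ofReal (potential f c ((1 - ε) ^ 2 * ρ) A) ≤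
      mean (randBatchLoop f c B ρ M 1 le_rfl ε k A A L count) fun R =>
        ENNReal.ofReal (potential f c ((1 - ε) ^ 2 * ρ) R.1) := by
  induction k generalizing A L count with
  | zero => simp [randBatchLoop, mean_pure]
  | succ k ih =>
    rw [randBatchLoop_succ]
    split_ifs with hif
    · rw [mean_pure]
    · rw [not_or] at hif
      rw [mean_bind]
      refine (le_mean_getSeq_stopped hf0 hc hρ hε1 h.fits).trans (mean_mono fun v hv => ?_)
      have hb := h.batchFacts hc hρ hε0 hε1 hif.1 hv
      rw [← hb.min_eq]
      exact ih _ _ _ (BatchState.next hc hb.feasible)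

theorem BatchState.initial (hc : ∀ u, 0 < c u) (hB : 0 < B) (I : Finset N) :
    BatchState f c B ρ ∅ (valuable f c B ρ I ∅) := by
  refine ⟨by simp [Feasible, cost, hB.le], by simp, fun u hu => ((mem_valuable hc).1 hu).2.1,
    fun u hu => ((mem_valuable hc).1 hu).2.2⟩

/-- In expectation, the output of `RandBatch` has density at least `(1 - ε)² ρ`. -/
theorem le_mean_randBatch (hf0 : ∀ X, 0 ≤ f X) (hc : ∀ u, 0 < c u) (hB : 0 < B) (hρ : 0 < ρ)
    (hε0 : 0 < ε) (hε1 : ε < 1) (M : ℕ) (I : Finset N) :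
    ENNReal.ofReal (potential f c ((1 - ε) ^ 2 * ρ) ∅) ≤
      mean (randBatch f c B ρ I M 1 le_rfl ε) fun R =>
        ENNReal.ofReal (potential f c ((1 - ε) ^ 2 * ρ) R.1) :=
  le_mean_randBatchLoop hf0 hc hρ hε0 hε1 M _ _ _ _ (BatchState.initial hc hB I)

end Batch

/-! ### What `RandBatch` guarantees surely: little dense gain is left. -/

section Termination

variable {N : Type u} [Fintype N] [DecidableEq N] {f : Finset N → ℝ} {c : N → ℝ} {B ρ ε : ℝ}

/-- The elements of `I ∖ A` that fit into `A` and have density at least `ρ` have total marginal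
gain at most `δ`. -/
def DenseGainLE (f : Finset N → ℝ) (c : N → ℝ) (B ρ δ : ℝ) (I A : Finset N) : Prop :=
  ∀ W ⊆ I \ A, (∀ u ∈ W, ρ * c u ≤ marginal f u A ∧ Feasible c B (insert u A)) →
    ∑ u ∈ W, marginal f u A ≤ δ

theorem DenseGainLE.mono (hf : Submodular f) (hc : ∀ u, 0 < c u) {δ : ℝ} {I A A' : Finset N}
    (h : DenseGainLE f c B ρ δ I A) (hA : A ⊆ A') : DenseGainLE f c B ρ δ I A' := by
  intro W hW hWd
  have hanti : ∀ u ∈ W, marginal f u A' ≤ marginal f u A := fun u hu =>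
    hf.marginal_anti hA (Finset.mem_sdiff.1 (hW hu)).2
  refine (Finset.sum_le_sum hanti).trans (h W (hW.trans (Finset.sdiff_subset_sdiff subset_rfl hA))
    fun u hu => ⟨(hWd u hu).1.trans (hanti u hu), (hWd u hu).2.mono hc ?_⟩)
  exact Finset.insert_subset_insert _ hA

/-- What would be gained by removing `D` from `A`, plus the sum of what would be lost by adding
single elements of `H` to `A`. -/
noncomputable def waste (f : Finset N → ℝ) (A D H : Finset N) : ℝ :=
  f (A \ D) - f A - ∑ u ∈ H, marginal f u A

/-- Both parts are controlled by feasibility and nonnegativity: `A \ D` is feasible, and `f(A)` plus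
the marginals of `H` is at least `f(A ∪ H) ≥ 0`. -/
theorem waste_le_OPT (hf : Submodular f) (hf0 : ∀ X, 0 ≤ f X) (hc : ∀ u, 0 < c u) {A : Finset N}
    (hA : Feasible c B A) (D H : Finset N) : waste f A D H ≤ OPT f c B := by
  have h1 : f (A \ D) ≤ OPT f c B := le_OPT (hA.mono hc Finset.sdiff_subset)
  have h2 := hf.union_le A H
  have h3 := hf0 (A ∪ H)
  unfold waste
  linarith

/-- The loop invariant of `RandBatch` started on `I`. -/
structure BatchInv (f : Finset N → ℝ) (c : N → ℝ) (B ρ ε : ℝ) (I A L : Finset N) (count : ℕ) :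
    Prop where
  state : BatchState f c B ρ A L
  subset : A ⊆ I
  subset' : L ⊆ I
  dropped : ∀ u ∈ I, u ∉ A → u ∉ L → ρ * c u ≤ marginal f u A → ¬ Feasible c B (insert u A)
  progress : DenseGainLE f c B ρ (ε * OPT f c B) I A ∨ ∃ D H : Finset N, D ⊆ A ∧ Disjoint H A ∧
    Disjoint H L ∧ 0 ≤ waste f A D H ∧
      (count = 0 ∨ count * (ε ^ 2 * OPT f c B) < waste f A D H)

theorem BatchInv.initial (hc : ∀ u, 0 < c u) (hB : 0 < B) (I : Finset N) :
    BatchInv f c B ρ ε I ∅ (valuable f c B ρ I ∅) 0 := by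
  refine ⟨BatchState.initial hc hB I, by simp, fun u hu => ((mem_valuable hc).1 hu).1, ?_, ?_⟩
  · intro u hu _ hu' hd hfe
    exact hu' ((mem_valuable hc).2 ⟨hu, hd, hfe⟩)
  · exact Or.inr ⟨∅, ∅, by simp, by simp, by simp, by simp [waste], Or.inl rfl⟩

/-- Each round adds its whole right-hand side `bad` of the `t₂` condition to the waste: batch
elements of negative gain go into `D`, harmful elements of `L` into `H`. The latter leave `L` for
good, so they never enter `A` and their marginals only decrease later. -/
theorem BatchInv.next (hf : Submodular f) (hc : ∀ u, 0 < c u) (hρ : 0 < ρ)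
    (hε0 : 0 < ε) (hε1 : ε < 1) {I A L : Finset N} {count : ℕ}
    (h : BatchInv f c B ρ ε I A L count) (hL : L ≠ ∅) {v : List N}
    (hv : v ∈ (getSeq c B A L).support) :
    BatchInv f c B ρ ε I
      (A ∪ (v.take (min (t₁ f c B ρ ε A L v) (t₂ f c B ρ ε A L v))).toFinset)
      (valuable f c B ρ
        (L \ (A ∪ (v.take (min (t₁ f c B ρ ε A L v) (t₂ f c B ρ ε A L v))).toFinset))
        (A ∪ (v.take (min (t₁ f c B ρ ε A L v) (t₂ f c B ρ ε A L v))).toFinset))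
      (if t₂ f c B ρ ε A L v < t₁ f c B ρ ε A L v then count + 1 else count) := by
  obtain ⟨-, hnd, hsub, -, hfeas, hround⟩ := h.state.batchFacts hc hρ hε0 hε1 hL hv
  set w := v.take (min (t₁ f c B ρ ε A L v) (t₂ f c B ρ ε A L v))
  set A' := A ∪ w.toFinset with hA'
  have hAA' : A ⊆ A' := Finset.subset_union_left
  -- Being too sparse or not fitting persists as `A` grows, so an element qualifying now was never
  -- dropped.
  have hdrop : ∀ u ∈ I, u ∉ A' → ρ * c u ≤ marginal f u A' → Feasible c B (insert u A') →
      u ∈ L := by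
    intro u hu huA hd hfe
    by_contra huL
    exact h.dropped u hu (fun h => huA (hAA' h)) huL (hd.trans (hf.marginal_anti hAA' huA))
      (hfe.mono hc (Finset.insert_subset_insert _ hAA'))
  refine ⟨BatchState.next hc hfeas, Finset.union_subset h.subset (hsub.trans h.subset'), ?_, ?_, ?_⟩
  · intro u hu
    exact h.subset' (Finset.mem_sdiff.1 ((mem_valuable hc).1 hu).1).1
  · intro u hu huA huL hd hfe
    exact huL ((mem_valuable hc).2
      ⟨Finset.mem_sdiff.2 ⟨hdrop u hu huA hd hfe, huA⟩, hd, hfe⟩)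
  rcases h.progress with hg | ⟨D, H, hD, hHA, hHL, hw0, hcount⟩
  · exact Or.inl (hg.mono hf hc hAA')
  set bad := ∑ u ∈ harmful f L A', |marginal f u A'| + listLoss f A w with hbad
  have hbad0 : 0 ≤ bad :=
    add_nonneg (Finset.sum_nonneg fun u _ => abs_nonneg _) (listLoss_nonneg _ _)
  obtain ⟨D', hD', hloss⟩ := hf.exists_add_listLoss_le w A D hD hnd fun a ha =>
    Finset.disjoint_left.1 h.state.disjoint (hsub (List.mem_toFinset.2 ha))
  have hHA' : Disjoint H A' := by
    rw [hA', Finset.disjoint_union_right]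
    exact ⟨hHA, hHL.mono_right hsub⟩
  have hHharm : Disjoint H (harmful f L A') :=
    hHL.mono_right fun u hu => (mem_harmful.1 hu).1
  have hwaste : waste f A D H + bad ≤ waste f A' D' (H ∪ harmful f L A') := by
    have h1 : ∑ u ∈ H, marginal f u A' ≤ ∑ u ∈ H, marginal f u A :=
      Finset.sum_le_sum fun u hu => hf.marginal_anti hAA' (Finset.disjoint_left.1 hHA' hu)
    have h2 : ∑ u ∈ harmful f L A', |marginal f u A'| =
        -∑ u ∈ harmful f L A', marginal f u A' := by
      rw [← Finset.sum_neg_distrib]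
      exact Finset.sum_congr rfl fun u hu => abs_of_neg (mem_harmful.1 hu).2
    unfold waste
    rw [Finset.sum_union hHharm]
    linarith
  have hres : ∀ n : ℕ, (n = 0 ∨ n * (ε ^ 2 * OPT f c B) < waste f A D H + bad) →
      ∃ D H : Finset N, D ⊆ A' ∧ Disjoint H A' ∧
      Disjoint H (valuable f c B ρ (L \ A') A') ∧ 0 ≤ waste f A' D H ∧
      (n = 0 ∨ n * (ε ^ 2 * OPT f c B) < waste f A' D H) := by
    intro n hn
    refine ⟨D', H ∪ harmful f L A', hD', ?_, ?_, by linarith, hn.imp_right fun h => by linarith⟩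
    · rw [Finset.disjoint_union_left]
      refine ⟨hHA', Finset.disjoint_left.2 fun u hu huA => ?_⟩
      have := (mem_harmful.1 hu).2
      rw [marginal_of_mem huA] at this
      exact lt_irrefl _ this
    · rw [Finset.disjoint_union_left]
      refine ⟨hHL.mono_right fun u hu => (Finset.mem_sdiff.1 ((mem_valuable hc).1 hu).1).1,
        Finset.disjoint_left.2 fun u hu hu' => ?_⟩
      have h1 := (mem_harmful.1 hu).2
      have h2 := ((mem_valuable hc).1 hu').2.1
      have := mul_pos hρ (hc u)
      linarith
  by_cases hlt : t₂ f c B ρ ε A L v < t₁ f c B ρ ε A L v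
  · rw [if_pos hlt]
    -- If `bad` is small, the `t₂` condition bounds the remaining dense gain by `bad / ε ≤ ε OPT`,
    -- and this persists. Otherwise the waste grows by more than `ε² OPT`, paying for the increase
    -- of `count`.
    by_cases hsmall : bad ≤ ε ^ 2 * OPT f c B
    · left
      intro W hW hWd
      have hs : ε * ∑ u ∈ valuable f c B ρ L A', marginal f u A' ≤ bad := hround hlt
      have hWsub : W ⊆ valuable f c B ρ L A' := by
        intro u hu
        obtain ⟨h1, h2⟩ := Finset.mem_sdiff.1 (hW hu)
        obtain ⟨h3, h4⟩ := hWd u hu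
        exact (mem_valuable hc).2 ⟨hdrop u h1 h2 h3 h4, h3, h4⟩
      refine (Finset.sum_le_sum_of_subset_of_nonneg hWsub fun u hu _ => ?_).trans
        (le_of_mul_le_mul_left (hs.trans (hsmall.trans (le_of_eq (by ring)))) hε0)
      exact (mul_pos hρ (hc u)).le.trans ((mem_valuable hc).1 hu).2.1
    · right
      refine hres _ (Or.inr ?_)
      push Not at hsmall
      push_cast
      rcases hcount with rfl | hcount
      · simp
        linarith
      · linarith
  · rw [if_neg hlt]
    right
    exact hres _ (hcount.imp_right fun h => by linarith)

theorem randBatchLoop_support (hf : Submodular f) (hf0 : ∀ X, 0 ≤ f X) (hc : ∀ u, 0 < c u)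
    (hρ : 0 < ρ) (hε0 : 0 < ε) (hε1 : ε < 1) {M : ℕ} (hM : (ε ^ 2)⁻¹ ≤ M) (hM0 : 0 < M)
    (I : Finset N) (k : ℕ) (A L : Finset N) (count : ℕ)
    (h : BatchInv f c B ρ ε I A L count) (hk : L.card ≤ k) (hOPT : 0 ≤ OPT f c B)
    {R : Finset N × Finset N × Finset N}
    (hR : R ∈ (randBatchLoop f c B ρ M 1 le_rfl ε k A A L count).support) :
    R.1 ⊆ I ∧ Feasible c B R.1 ∧ DenseGainLE f c B ρ (ε * OPT f c B) I R.1 := by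
  have hempty : ∀ A count, BatchInv f c B ρ ε I A ∅ count →
      DenseGainLE f c B ρ (ε * OPT f c B) I A := by
    intro A count h W hW hWd
    have : W = ∅ := by
      rw [Finset.eq_empty_iff_forall_notMem]
      intro u hu
      obtain ⟨h1, h2⟩ := Finset.mem_sdiff.1 (hW hu)
      exact h.dropped u h1 h2 (by simp) (hWd u hu).1 (hWd u hu).2
    rw [this, Finset.sum_empty]
    positivity
  induction k generalizing A L count with
  | zero =>
    simp only [randBatchLoop, PMF.support_pure, Set.mem_singleton_iff] at hR
    subst hR
    obtain rfl : L = ∅ := Finset.card_eq_zero.1 (by omega)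
    exact ⟨h.subset, h.state.feasible, hempty _ _ h⟩
  | succ k ih =>
    rw [randBatchLoop_succ] at hR
    split_ifs at hR with hif
    · simp only [PMF.support_pure, Set.mem_singleton_iff] at hR
      subst hR
      refine ⟨h.subset, h.state.feasible, ?_⟩
      rcases hif with rfl | hcount
      · exact hempty _ _ h
      · rcases h.progress with hg | ⟨D, H, -, -, -, -, hw⟩
        · exact hg
        -- Here `count * ε² ≥ 1`, so the waste would strictly exceed `OPT`.
        · exfalso
          have h1 := hw.resolve_left (by omega)
          have h2 := waste_le_OPT hf hf0 hc h.state.feasible D H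
          have h3 : (ε ^ 2)⁻¹ ≤ count := hM.trans (by exact_mod_cast hcount)
          have h4 : 1 ≤ count * ε ^ 2 := by
            rwa [inv_le_iff_one_le_mul₀ (by positivity)] at h3
          nlinarith
    · rw [not_or] at hif
      rw [PMF.mem_support_bind_iff] at hR
      obtain ⟨v, hv, hR⟩ := hR
      refine ih _ _ _ (h.next hf hc hρ hε0 hε1 hif.1 hv) ?_ hR
      have hb := h.state.batchFacts hc hρ hε0 hε1 hif.1 hv
      obtain ⟨a, ha⟩ := hb.nonempty
      have hlt : valuable f c B ρ
          (L \ (A ∪ (v.take (min (t₁ f c B ρ ε A L v) (t₂ f c B ρ ε A L v))).toFinset))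
          (A ∪ (v.take (min (t₁ f c B ρ ε A L v) (t₂ f c B ρ ε A L v))).toFinset) ⊂ L := by
        refine (Finset.ssubset_iff_of_subset fun u hu =>
          (Finset.mem_sdiff.1 ((mem_valuable hc).1 hu).1).1).2 ⟨a, hb.subset ha, fun h => ?_⟩
        exact (Finset.mem_sdiff.1 ((mem_valuable hc).1 h).1).2 (Finset.mem_union_right _ ha)
      have := Finset.card_lt_card hlt
      omega

theorem OPT_nonneg (hf0 : ∀ X, 0 ≤ f X) (hB : 0 < B) : 0 ≤ OPT f c B := by
  obtain ⟨X, -, hX⟩ := exists_eq_OPT (f := f) (c := c) hB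
  exact hX ▸ hf0 X

theorem randBatch_support (hf : Submodular f) (hf0 : ∀ X, 0 ≤ f X) (hc : ∀ u, 0 < c u)
    (hB : 0 < B) (hρ : 0 < ρ) (hε0 : 0 < ε) (hε1 : ε < 1) {I : Finset N}
    {R : Finset N × Finset N × Finset N}
    (hR : R ∈ (randBatch f c B ρ I ⌈(ε ^ 2)⁻¹⌉₊ 1 le_rfl ε).support) :
    R.1 ⊆ I ∧ Feasible c B R.1 ∧ DenseGainLE f c B ρ (ε * OPT f c B) I R.1 :=
  randBatchLoop_support hf hf0 hc hρ hε0 hε1 (Nat.le_ceil _)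
    (Nat.ceil_pos.2 (by positivity)) I _ _ _ _ (BatchInv.initial hc hB I)
    (Finset.card_le_card fun _ hu => ((mem_valuable hc).1 hu).1) (OPT_nonneg hf0 hB) hR

/-- If every element of `O` fits into the output `A` of `RandBatch`, then adding `O` gains at most
`ρ c(O)` up to a small error. -/
theorem DenseGainLE.union_le (hf : Submodular f) (hc : ∀ u, 0 < c u) (hρ : 0 < ρ) {δ : ℝ}
    {I A O : Finset N} (h : DenseGainLE f c B ρ δ I A) (hO : O ⊆ I)
    (hfit : ∀ u ∈ O, Feasible c B (insert u A)) : f (A ∪ O) ≤ f A + ρ * cost c O + δ := by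
  have h1 := hf.union_le A (O \ A)
  rw [Finset.union_sdiff_self_eq_union,
    ← Finset.sum_filter_add_sum_filter_not _ (fun u => ρ * c u ≤ marginal f u A)] at h1
  have h2 := h ((O \ A).filter fun u => ρ * c u ≤ marginal f u A)
    ((Finset.filter_subset _ _).trans (Finset.sdiff_subset_sdiff hO subset_rfl))
    (fun u hu => ⟨(Finset.mem_filter.1 hu).2,
      hfit u (Finset.mem_sdiff.1 (Finset.mem_filter.1 hu).1).1⟩)
  have h3 : ∑ u ∈ (O \ A).filter (fun u => ¬ ρ * c u ≤ marginal f u A), marginal f u A ≤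
      ρ * cost c O := by
    unfold cost
    rw [Finset.mul_sum]
    refine (Finset.sum_le_sum fun u hu => (not_le.1 (Finset.mem_filter.1 hu).2).le).trans
      (Finset.sum_le_sum_of_subset_of_nonneg
        ((Finset.filter_subset _ _).trans Finset.sdiff_subset) fun u _ _ =>
          (mul_pos hρ (hc u)).le)
  linarith

end Termination

/-! ### Real expectations on finite types. -/

section Average

variable {α β : Type*} [Fintype α] [Fintype β]

/-- The expectation of a real function under a law on a finite type. -/
noncomputable def avg (P : PMF α) (g : α → ℝ) : ℝ := ∑ a, (P a).toReal * g a

theorem avg_pure (a : α) (g : α → ℝ) : avg (PMF.pure a) g = g a := by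
  unfold avg
  rw [Finset.sum_eq_single a]
  · simp
  · intro b _ hb
    simp [PMF.pure_apply, hb]
  · simp

theorem avg_bind (P : PMF α) (Q : α → PMF β) (g : β → ℝ) :
    avg (P.bind Q) g = avg P fun a => avg (Q a) g := by
  have h : ∀ b, ((P.bind Q) b).toReal = ∑ a, (P a).toReal * (Q a b).toReal := by
    intro b
    rw [PMF.bind_apply, tsum_fintype, ENNReal.toReal_sum]
    · simp_rw [ENNReal.toReal_mul]
    · intro a _
      exact ENNReal.mul_ne_top (P.apply_ne_top a) ((Q a).apply_ne_top b)
  unfold avg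
  simp_rw [h, Finset.sum_mul, Finset.mul_sum]
  rw [Finset.sum_comm]
  simp_rw [mul_assoc]

theorem avg_map (P : PMF α) (h : α → β) (g : β → ℝ) :
    avg (P.map h) g = avg P fun a => g (h a) := by
  rw [PMF.map, avg_bind]
  simp [avg_pure]

theorem avg_mono {P : PMF α} {g h : α → ℝ} (H : ∀ a ∈ P.support, g a ≤ h a) :
    avg P g ≤ avg P h := by
  refine Finset.sum_le_sum fun a _ => ?_
  by_cases ha : a ∈ P.support
  · exact mul_le_mul_of_nonneg_left (H a ha) ENNReal.toReal_nonneg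
  · rw [PMF.mem_support_iff, not_not] at ha
    simp [ha]

theorem avg_const (P : PMF α) (x : ℝ) : avg P (fun _ => x) = x := by
  unfold avg
  rw [← Finset.sum_mul, sum_toReal_eq_one, one_mul]

theorem avg_add (P : PMF α) (g h : α → ℝ) : avg P (fun a => g a + h a) = avg P g + avg P h := by
  simp [avg, mul_add, Finset.sum_add_distrib]

theorem avg_mul_left (P : PMF α) (x : ℝ) (g : α → ℝ) : avg P (fun a => x * g a) = x * avg P g := by
  unfold avg
  rw [Finset.mul_sum]
  exact Finset.sum_congr rfl fun a _ => by ring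

theorem le_avg {P : PMF α} {x : ℝ} {g : α → ℝ} (H : ∀ a ∈ P.support, x ≤ g a) : x ≤ avg P g := by
  rw [← avg_const P x]
  exact avg_mono H

end Average

/-! ### One run of `Probe`. -/

section Probe

variable {N : Type u} [Fintype N] [DecidableEq N] {f : Finset N → ℝ} {c : N → ℝ} {B ρ ε : ℝ}
  {usm : Finset N → PMF (Finset N)}

theorem le_better_left (S T : Finset N) : f S ≤ f (better f S T) := by
  unfold better
  split_ifs with h
  · exact h.le
  · exact le_rfl

theorem le_better_right (S T : Finset N) : f T ≤ f (better f S T) := by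
  unfold better
  split_ifs with h
  · exact le_rfl
  · exact not_lt.1 h

theorem feasible_better {S T : Finset N} (hS : Feasible c B S) (hT : Feasible c B T) :
    Feasible c B (better f S T) := by
  unfold better
  split_ifs
  · exact hT
  · exact hS

theorem feasible_augment {A : Finset N} (hA : Feasible c B A) (N₁ : Finset N) :
    Feasible c B (augment f c B N₁ A) := by
  classical
  unfold augment
  split_ifs with h
  · exact (Finset.mem_filter.1 (Finset.exists_max_image _ (fun u => f (insert u A)) h).choose_spec.1).2
  · exact hA

theorem le_augment {A N₁ : Finset N} {u : N} (hu : u ∈ N₁) (hf : Feasible c B (insert u A)) :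
    f (insert u A) ≤ f (augment f c B N₁ A) := by
  classical
  have hmem : u ∈ N₁.filter fun u => Feasible c B (insert u A) := Finset.mem_filter.2 ⟨hu, hf⟩
  unfold augment
  rw [dif_pos ⟨u, by convert hmem⟩]
  exact (Finset.exists_max_image _ (fun u => f (insert u A)) ⟨u, hmem⟩).choose_spec.2 u hmem

/-- The joint law of the two sets `A₁`, `A₂` made by `Probe`. -/
noncomputable def pairLaw (f : Finset N → ℝ) (c : N → ℝ) (B ρ ε : ℝ) (N₁ : Finset N) :
    PMF (Finset N × Finset N) :=
  (randBatch f c B ρ N₁ ⌈(ε ^ 2)⁻¹⌉₊ 1 le_rfl ε).bind fun R₁ =>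
    (randBatch f c B ρ (N₁ \ R₁.1) ⌈(ε ^ 2)⁻¹⌉₊ 1 le_rfl ε).map fun R₂ => (R₁.1, R₂.1)

/-- The best of the candidates of `Probe` that do not involve `USM`. -/
noncomputable def bestCandidate (f : Finset N → ℝ) (c : N → ℝ) (B : ℝ) (N₁ A₁ A₂ : Finset N) :
    Finset N :=
  better f (better f (better f (better f ∅ A₁) (augment f c B N₁ A₁)) A₂) (augment f c B N₁ A₂)

/-- The law of the output of `Probe` once `A₁` and `A₂` are known. -/
noncomputable def probeFinish (f : Finset N → ℝ) (c : N → ℝ) (B : ℝ)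
    (usm : Finset N → PMF (Finset N)) (N₁ N₂ A₁ A₂ : Finset N) : PMF (Finset N) :=
  open Classical in
  if Feasible c B (N₂ ∪ A₁) then
    (usm (N₂ ∪ A₁)).map fun A₃ => better f (bestCandidate f c B N₁ A₁ A₂) A₃
  else PMF.pure (bestCandidate f c B N₁ A₁ A₂)

/-- Separates the batches from `USM`, so that luck can be an event about `(A₁, A₂)` alone. -/
theorem probe_eq_bind (N₁ N₂ : Finset N) :
    probe f c B usm ρ N₁ N₂ ε =
      (pairLaw f c B ρ ε N₁).bind fun p => probeFinish f c B usm N₁ N₂ p.1 p.2 := by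
  unfold pairLaw
  rw [PMF.bind_bind]
  simp_rw [PMF.bind_map]
  rfl

theorem le_bestCandidate (N₁ A₁ A₂ : Finset N) :
    f A₁ ≤ f (bestCandidate f c B N₁ A₁ A₂) ∧
    f (augment f c B N₁ A₁) ≤ f (bestCandidate f c B N₁ A₁ A₂) ∧
    f A₂ ≤ f (bestCandidate f c B N₁ A₁ A₂) ∧
    f (augment f c B N₁ A₂) ≤ f (bestCandidate f c B N₁ A₁ A₂) := by
  unfold bestCandidate
  refine ⟨?_, ?_, ?_, le_better_right _ _⟩
  · exact (le_better_right _ _).trans ((le_better_left _ _).trans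
      ((le_better_left _ _).trans (le_better_left _ _)))
  · exact (le_better_right _ _).trans ((le_better_left _ _).trans (le_better_left _ _))
  · exact (le_better_right _ _).trans (le_better_left _ _)

theorem bestCandidate_le_avg (N₁ N₂ A₁ A₂ : Finset N) :
    f (bestCandidate f c B N₁ A₁ A₂) ≤ avg (probeFinish f c B usm N₁ N₂ A₁ A₂) f := by
  unfold probeFinish
  split_ifs
  · rw [avg_map]
    exact le_avg fun _ _ => le_better_left _ _
  · rw [avg_pure]

theorem usm_le_avg {N₁ N₂ A₁ A₂ : Finset N} (h : Feasible c B (N₂ ∪ A₁)) :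
    avg (usm (N₂ ∪ A₁)) f ≤ avg (probeFinish f c B usm N₁ N₂ A₁ A₂) f := by
  unfold probeFinish
  rw [if_pos h, avg_map]
  exact avg_mono fun _ _ => le_better_right _ _

theorem pairLaw_support (hf : Submodular f) (hf0 : ∀ X, 0 ≤ f X) (hc : ∀ u, 0 < c u)
    (hB : 0 < B) (hρ : 0 < ρ) (hε0 : 0 < ε) (hε1 : ε < 1) {N₁ : Finset N}
    {p : Finset N × Finset N} (hp : p ∈ (pairLaw f c B ρ ε N₁).support) :
    (p.1 ⊆ N₁ ∧ Feasible c B p.1 ∧ DenseGainLE f c B ρ (ε * OPT f c B) N₁ p.1) ∧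
      p.2 ⊆ N₁ \ p.1 ∧ Feasible c B p.2 ∧
        DenseGainLE f c B ρ (ε * OPT f c B) (N₁ \ p.1) p.2 := by
  unfold pairLaw at hp
  rw [PMF.mem_support_bind_iff] at hp
  obtain ⟨R₁, hR₁, hp⟩ := hp
  rw [PMF.mem_support_map_iff] at hp
  obtain ⟨R₂, hR₂, rfl⟩ := hp
  exact ⟨randBatch_support hf hf0 hc hB hρ hε0 hε1 hR₁,
    randBatch_support hf hf0 hc hB hρ hε0 hε1 hR₂⟩

theorem feasible_of_mem_probe_support (hf : Submodular f) (hf0 : ∀ X, 0 ≤ f X)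
    (hc : ∀ u, 0 < c u) (hB : 0 < B) (hρ : 0 < ρ) (hε0 : 0 < ε) (hε1 : ε < 1)
    (husm : IsUSM (2 + ε) f usm) {N₁ N₂ S : Finset N}
    (hS : S ∈ (probe f c B usm ρ N₁ N₂ ε).support) : Feasible c B S := by
  rw [probe_eq_bind, PMF.mem_support_bind_iff] at hS
  obtain ⟨p, hp, hS⟩ := hS
  obtain ⟨⟨-, h1, -⟩, -, h2, -⟩ := pairLaw_support hf hf0 hc hB hρ hε0 hε1 hp
  have hbest : Feasible c B (bestCandidate f c B N₁ p.1 p.2) := by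
    have h0 : Feasible c B ∅ := by simp [Feasible, cost, hB.le]
    exact feasible_better (feasible_better (feasible_better (feasible_better h0 h1)
      (feasible_augment h1 _)) h2) (feasible_augment h2 _)
  unfold probeFinish at hS
  split_ifs at hS with h
  · rw [PMF.mem_support_map_iff] at hS
    obtain ⟨A₃, hA₃, rfl⟩ := hS
    exact feasible_better hbest (h.mono hc ((husm _).1 A₃ hA₃))
  · simp only [PMF.support_pure, Set.mem_singleton_iff] at hS
    exact hS ▸ hbest

theorem avg_randBatch_ge (hf0 : ∀ X, 0 ≤ f X) (hc : ∀ u, 0 < c u) (hB : 0 < B) (hρ : 0 < ρ)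
    (hε0 : 0 < ε) (hε1 : ε < 1) (M : ℕ) (I : Finset N) :
    (1 - ε) ^ 2 * ρ * avg (randBatch f c B ρ I M 1 le_rfl ε) (fun R => cost c R.1) ≤
      avg (randBatch f c B ρ I M 1 le_rfl ε) fun R => f R.1 := by
  have hκ : 0 ≤ (1 - ε) ^ 2 * ρ := by positivity
  have h := le_mean_randBatch hf0 hc hB hρ hε0 hε1 M I
  set κ := (1 - ε) ^ 2 * ρ with hκdef
  set P := randBatch f c B ρ I M 1 le_rfl ε
  rw [mean_ofReal P (g := fun R => potential f c κ R.1)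
    fun R => potential_nonneg hf0 hc hκ R.1, ENNReal.ofReal_le_ofReal_iff] at h
  · have he : ∑ a, (P a).toReal * potential f c κ a.1 =
        avg P (fun R => f R.1) +
          (κ * cost c Finset.univ + -κ * avg P (fun R => cost c R.1)) := by
      rw [← avg_mul_left, ← avg_const P (κ * cost c Finset.univ), ← avg_add, ← avg_add]
      refine Finset.sum_congr rfl fun R _ => ?_
      unfold potential
      ring
    rw [he] at h
    have h0 := hf0 ∅
    have h1 : potential f c κ ∅ = f ∅ + κ * cost c Finset.univ := by
      simp [potential, cost]
    linarith
  · exact Finset.sum_nonneg fun R _ =>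
      mul_nonneg ENNReal.toReal_nonneg (potential_nonneg hf0 hc hκ R.1)

theorem avg_pairLaw_ge (hf0 : ∀ X, 0 ≤ f X) (hc : ∀ u, 0 < c u) (hB : 0 < B) (hρ : 0 < ρ)
    (hε0 : 0 < ε) (hε1 : ε < 1) (N₁ : Finset N) :
    (1 - ε) ^ 2 * ρ * avg (pairLaw f c B ρ ε N₁) (fun p => cost c p.1 + cost c p.2) ≤
      avg (pairLaw f c B ρ ε N₁) fun p => f p.1 + f p.2 := by
  rw [avg_add, avg_add, mul_add]
  refine add_le_add ?_ ?_
  · unfold pairLaw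
    simp only [avg_bind, avg_map, avg_const]
    exact avg_randBatch_ge hf0 hc hB hρ hε0 hε1 _ _
  · unfold pairLaw
    simp only [avg_bind, avg_map]
    rw [← avg_mul_left]
    exact avg_mono fun R _ => avg_randBatch_ge hf0 hc hB hρ hε0 hε1 _ _

theorem cost_union_le (hc : ∀ u, 0 < c u) (X Y : Finset N) :
    cost c (X ∪ Y) ≤ cost c X + cost c Y := by
  unfold cost
  rw [← Finset.sum_union_inter]
  exact le_add_of_nonneg_right (Finset.sum_nonneg fun u _ => (hc u).le)

/-- Adding the elements of an optimal solution to `A` gains little beyond the best single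
augmentation. -/
theorem union_le_of_denseGainLE (hf : Submodular f) (hc : ∀ u, 0 < c u) (hρ : 0 < ρ) {δ X : ℝ}
    {N₁ I A O Q : Finset N} {o : N} (h : DenseGainLE f c B ρ δ I A) (hQI : Q ⊆ I) (hQO : Q ⊆ O)
    (hI : I ⊆ N₁) (ho : o ∈ O) (hOB : cost c O ≤ B) (hmax : ∀ u ∈ O, c u ≤ c o)
    (hA : cost c A ≤ B - c o) (hX : f A ≤ X) (hX' : f (augment f c B N₁ A) ≤ X) :
    f (A ∪ Q) ≤ X + ρ * (B - c o) + δ := by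
  have hfit : ∀ u ∈ O, Feasible c B (insert u A) := by
    intro u hu
    have h1 := cost_insert_le hc u A
    have h2 := hmax u hu
    unfold Feasible
    linarith
  have hcost : cost c (Q.erase o) ≤ B - c o := by
    have h1 : cost c (Q.erase o) ≤ cost c (O.erase o) :=
      cost_mono hc (Finset.erase_subset_erase _ hQO)
    have h2 : cost c (O.erase o) + c o = cost c O := Finset.sum_erase_add _ _ ho
    linarith
  have h1 := h.union_le hf hc hρ ((Finset.erase_subset o Q).trans hQI)
    fun u hu => hfit u (hQO (Finset.mem_of_mem_erase hu))
  have h2 := mul_le_mul_of_nonneg_left hcost hρ.le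
  -- Without `o`, the set `Q` costs at most `B - c(o)`. The element `o` itself is paid for by the
  -- augmentation: `f(A ∪ Q) + f(A) ≤ f(A ∪ {o}) + f(A ∪ (Q \ {o}))`.
  by_cases hoQ : o ∈ Q
  · have h3 := hf (insert o A) (A ∪ Q.erase o)
    have hu : insert o A ∪ (A ∪ Q.erase o) = A ∪ Q := by
      ext x
      simp only [Finset.mem_union, Finset.mem_insert, Finset.mem_erase]
      by_cases hx : x = o
      · simp [hx, hoQ]
      · simp [hx]
    have hi : insert o A ∩ (A ∪ Q.erase o) = A := by
      ext x
      simp only [Finset.mem_union, Finset.mem_insert, Finset.mem_erase, Finset.mem_inter]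
      tauto
    rw [hu, hi] at h3
    have h4 := le_augment (f := f) (hI (hQI hoQ)) (hfit o ho)
    linarith
  · rw [Finset.erase_eq_of_notMem hoQ] at h1 h2
    linarith

/-- The value of `Probe` when both batches leave room for the most expensive element of the
optimal solution. -/
theorem OPT_le_of_small_cost (hf : Submodular f) (hf0 : ∀ X, 0 ≤ f X) (hc : ∀ u, 0 < c u)
    (hρ : 0 < ρ) (hε0 : 0 < ε)
    (husm : IsUSM (2 + ε) f usm) {N₁ N₂ O₁ O₂ A₁ A₂ : Finset N} {o : N}
    (hA₁ : DenseGainLE f c B ρ (ε * OPT f c B) N₁ A₁)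
    (hA₂N : A₂ ⊆ N₁ \ A₁) (hA₂ : DenseGainLE f c B ρ (ε * OPT f c B) (N₁ \ A₁) A₂)
    (hO₁ : O₁ ⊆ N₁) (hO₂ : O₂ ⊆ N₂) (ho : o ∈ O₁) (hmax : ∀ u ∈ O₁, c u ≤ c o)
    (hOB : cost c O₁ ≤ B) (hOPT : f (O₁ ∪ O₂) = OPT f c B) (hN₂ : cost c N₂ ≤ ε * B)
    (h₁ : cost c A₁ ≤ min (B - c o) ((1 - ε) * B))
    (h₂ : cost c A₂ ≤ min (B - c o) ((1 - ε) * B)) :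
    OPT f c B ≤ (4 + ε) * avg (probeFinish f c B usm N₁ N₂ A₁ A₂) f + 2 * (ρ * (B - c o)) +
      2 * (ε * OPT f c B) := by
  set X := avg (probeFinish f c B usm N₁ N₂ A₁ A₂) f
  have hbest : f (bestCandidate f c B N₁ A₁ A₂) ≤ X := bestCandidate_le_avg N₁ N₂ A₁ A₂
  obtain ⟨b1, b2, b3, b4⟩ := le_bestCandidate (f := f) (c := c) (B := B) N₁ A₁ A₂
  -- The bound `(1-ε)B` on `c(A₁)` leaves room for the cheap elements, of total cost at most `εB`.
  have hfeas : Feasible c B (N₂ ∪ A₁) := by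
    have := cost_union_le hc N₂ A₁
    have := h₁.trans (min_le_right _ _)
    unfold Feasible
    linarith
  have hu : f (O₁ ∩ A₁ ∪ O₂) ≤ (2 + ε) * X := by
    have hle := (husm (N₂ ∪ A₁)).2 (O₁ ∩ A₁ ∪ O₂) ?_
    · refine hle.trans (mul_le_mul_of_nonneg_left (usm_le_avg hfeas) (by linarith))
    · refine Finset.union_subset (Finset.inter_subset_right.trans Finset.subset_union_right)
        (hO₂.trans Finset.subset_union_left)
  have g1 : f (A₁ ∪ O₁) ≤ X + ρ * (B - c o) + ε * OPT f c B :=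
    union_le_of_denseGainLE hf hc hρ hA₁ hO₁ subset_rfl subset_rfl ho hOB hmax
      (h₁.trans (min_le_left _ _)) (b1.trans hbest) (b2.trans hbest)
  have g2 : f (A₂ ∪ O₁ \ A₁) ≤ X + ρ * (B - c o) + ε * OPT f c B :=
    union_le_of_denseGainLE hf hc hρ hA₂ (Finset.sdiff_subset_sdiff hO₁ subset_rfl)
      Finset.sdiff_subset Finset.sdiff_subset ho hOB hmax
      (h₂.trans (min_le_left _ _)) (b3.trans hbest) (b4.trans hbest)
  have s1 := hf (A₁ ∪ O₁) (A₂ ∪ O₁ \ A₁)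
  -- This is why the second batch avoids `A₁`: the two unions then meet exactly in `O₁ \ A₁`.
  have hi : (A₁ ∪ O₁) ∩ (A₂ ∪ O₁ \ A₁) = O₁ \ A₁ := by
    ext x
    have hx : x ∈ A₂ → x ∉ A₁ := fun h => (Finset.mem_sdiff.1 (hA₂N h)).2
    simp only [Finset.mem_union, Finset.mem_inter, Finset.mem_sdiff]
    tauto
  rw [hi] at s1
  have s2 := hf (O₁ \ A₁) (O₁ ∩ A₁ ∪ O₂)
  have hun : O₁ \ A₁ ∪ (O₁ ∩ A₁ ∪ O₂) = O₁ ∪ O₂ := by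
    ext x
    simp only [Finset.mem_union, Finset.mem_inter, Finset.mem_sdiff]
    tauto
  rw [hun, hOPT] at s2
  have n1 := hf0 (A₁ ∪ O₁ ∪ (A₂ ∪ O₁ \ A₁))
  have n2 := hf0 (O₁ \ A₁ ∩ (O₁ ∩ A₁ ∪ O₂))
  linarith

end Probe

/-! ### Repeating `Probe` and keeping the best set. -/

section Runs

variable {N : Type u} [Fintype N] [DecidableEq N] {f : Finset N → ℝ} {c : N → ℝ} {B ρ ε : ℝ}
  {usm : Finset N → PMF (Finset N)}

theorem le_avg_bestOfRuns (P : PMF (Finset N)) (k : ℕ) (S : Finset N) :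
    f S ≤ avg (bestOfRuns f P k S) f := by
  induction k generalizing S with
  | zero => rw [bestOfRuns, avg_pure]
  | succ k ih =>
    rw [bestOfRuns, avg_bind]
    exact le_avg fun T _ => (le_better_left S T).trans (ih _)

theorem avg_le_avg_bestOfRuns (P : PMF (Finset N)) {k : ℕ} (hk : 0 < k) (S : Finset N) :
    avg P f ≤ avg (bestOfRuns f P k S) f := by
  obtain ⟨k, rfl⟩ : ∃ m, k = m + 1 := ⟨k - 1, by omega⟩
  rw [bestOfRuns, avg_bind]
  exact avg_mono fun T _ => (le_better_right S T).trans (le_avg_bestOfRuns P k _)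

/-- If a run is lucky with probability at least `ε`, and a lucky run has expected value at least
`x`, then the best of `k` runs has expected value at least `(1 - (1 - ε)ᵏ) x`. -/
theorem le_avg_bestOfRuns_of_lucky (hf0 : ∀ X, 0 ≤ f X) {α : Type*} [Fintype α] (μ : PMF α)
    (Q : α → PMF (Finset N)) (lucky : α → Prop) [DecidablePred lucky] {x : ℝ} (hx : 0 ≤ x)
    (hε1 : ε < 1) (hμ : ε ≤ avg μ fun a => if lucky a then 1 else 0)
    (hQ : ∀ a ∈ μ.support, lucky a → x ≤ avg (Q a) f) (k : ℕ) (S : Finset N) :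
    (1 - (1 - ε) ^ k) * x ≤ avg (bestOfRuns f (μ.bind Q) k S) f := by
  induction k generalizing S with
  | zero =>
    rw [bestOfRuns, avg_pure]
    simpa using hf0 S
  | succ k ih =>
    rw [bestOfRuns, avg_bind, avg_bind]
    set y := (1 - (1 - ε) ^ k) * x
    have hyx : 0 ≤ x - y := by
      have : 0 ≤ (1 - ε) ^ k * x := mul_nonneg (pow_nonneg (by linarith) _) hx
      have : x - y = (1 - ε) ^ k * x := by
        simp only [y]
        ring
      linarith
    -- The remaining runs guarantee `y` in any case; a lucky first run raises this to `x ≥ y`.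
    have hle : avg μ (fun a => y + (x - y) * if lucky a then 1 else 0) ≤
        avg μ fun a => avg (Q a) fun T => avg (bestOfRuns f (μ.bind Q) k (better f S T)) f := by
      refine avg_mono fun a ha => ?_
      split_ifs with hl
      · have h1 : avg (Q a) f ≤
            avg (Q a) fun T => avg (bestOfRuns f (μ.bind Q) k (better f S T)) f :=
          avg_mono fun T _ => (le_better_right S T).trans (le_avg_bestOfRuns _ k _)
        have h2 := hQ a ha hl
        linarith
      · have h1 : y ≤ avg (Q a) fun T => avg (bestOfRuns f (μ.bind Q) k (better f S T)) f :=
          le_avg fun T _ => ih _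
        linarith
    rw [avg_add, avg_const, avg_mul_left] at hle
    have hmul := mul_le_mul_of_nonneg_left hμ hyx
    have : (1 - (1 - ε) ^ (k + 1)) * x = y + (x - y) * ε := by
      simp only [y]
      ring
    linarith

theorem le_avg_bestOverThresholds (P : ℝ → PMF (Finset N)) (K : ℕ) (Z : List ℝ) (S : Finset N) :
    f S ≤ avg (bestOverThresholds f P K Z S) f := by
  induction Z generalizing S with
  | nil => rw [bestOverThresholds, avg_pure]
  | cons ρ Z ih =>
    rw [bestOverThresholds, avg_bind]
    exact (le_avg_bestOfRuns (P ρ) K S).trans (avg_mono fun T _ => ih T)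

theorem le_avg_bestOverThresholds_of_mem {P : ℝ → PMF (Finset N)} {K : ℕ} {Z : List ℝ}
    (hρ : ρ ∈ Z) {x : ℝ} (hx : ∀ S, x ≤ avg (bestOfRuns f (P ρ) K S) f) (S : Finset N) :
    x ≤ avg (bestOverThresholds f P K Z S) f := by
  induction Z generalizing S with
  | nil => simp at hρ
  | cons ρ' Z ih =>
    rw [bestOverThresholds, avg_bind]
    rcases List.mem_cons.1 hρ with rfl | hρ
    · exact (hx S).trans (avg_mono fun T _ => le_avg_bestOverThresholds P K Z T)
    · exact le_avg fun T _ => ih hρ T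

theorem feasible_of_mem_bestOfRuns_support {P : PMF (Finset N)}
    (hP : ∀ T ∈ P.support, Feasible c B T) (k : ℕ) {S T : Finset N} (hS : Feasible c B S)
    (hT : T ∈ (bestOfRuns f P k S).support) : Feasible c B T := by
  induction k generalizing S with
  | zero =>
    simp only [bestOfRuns, PMF.support_pure, Set.mem_singleton_iff] at hT
    exact hT ▸ hS
  | succ k ih =>
    rw [bestOfRuns, PMF.mem_support_bind_iff] at hT
    obtain ⟨R, hR, hT⟩ := hT
    exact ih (feasible_better hS (hP R hR)) hT

theorem feasible_of_mem_bestOverThresholds_support {P : ℝ → PMF (Finset N)} {K : ℕ} {Z : List ℝ}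
    (hP : ∀ ρ ∈ Z, ∀ T ∈ (P ρ).support, Feasible c B T) {S T : Finset N} (hS : Feasible c B S)
    (hT : T ∈ (bestOverThresholds f P K Z S).support) : Feasible c B T := by
  induction Z generalizing S with
  | nil =>
    simp only [bestOverThresholds, PMF.support_pure, Set.mem_singleton_iff] at hT
    exact hT ▸ hS
  | cons ρ Z ih =>
    rw [bestOverThresholds, PMF.mem_support_bind_iff] at hT
    obtain ⟨R, hR, hT⟩ := hT
    exact ih (fun ρ' h' => hP ρ' (List.mem_cons_of_mem _ h'))
      (feasible_of_mem_bestOfRuns_support (hP ρ (by simp)) K hS hR) hT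

theorem pow_ceil_logb_le (hε0 : 0 < ε) (hε1 : ε < 1) :
    (1 - ε) ^ ⌈Real.logb (1 - ε) ε⌉₊ ≤ ε := by
  have h := Nat.le_ceil (Real.logb (1 - ε) ε)
  have h1 := Real.rpow_le_rpow_of_exponent_ge (x := 1 - ε) (by linarith) (by linarith) h
  rwa [Real.rpow_logb (by linarith) (by linarith) hε0, Real.rpow_natCast] at h1

theorem ceil_logb_pos (hε0 : 0 < ε) (hε1 : ε < 1) : 0 < ⌈Real.logb (1 - ε) ε⌉₊ :=
  Nat.ceil_pos.2 (Real.logb_pos_of_base_lt_one (by linarith) (by linarith) hε0 hε1)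

/-- For a threshold close to `OPT / (4 (B - c(o)))`, repeated runs of `Probe` find a good
solution. -/
theorem le_avg_bestOfRuns_probe (hf : Submodular f) (hf0 : ∀ X, 0 ≤ f X) (hc : ∀ u, 0 < c u)
    (hB : 0 < B) (hρ : 0 < ρ) (hε0 : 0 < ε) (hε8 : ε < 1 / 8) (husm : IsUSM (2 + ε) f usm)
    {N₁ N₂ O₁ O₂ : Finset N} {o : N} (hO₁ : O₁ ⊆ N₁) (hO₂ : O₂ ⊆ N₂) (ho : o ∈ O₁)
    (hmax : ∀ u ∈ O₁, c u ≤ c o) (hOB : cost c O₁ ≤ B) (hOPT : f (O₁ ∪ O₂) = OPT f c B)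
    (hN₂ : cost c N₂ ≤ ε * B) (hoB : c o ≤ B)
    (hlo : (1 - ε) * OPT f c B ≤ 4 * (ρ * (B - c o))) (hhi : 4 * (ρ * (B - c o)) ≤ OPT f c B)
    (S : Finset N) :
    (1 / 8 - ε) * OPT f c B ≤
      avg (bestOfRuns f (probe f c B usm ρ N₁ N₂ ε) ⌈Real.logb (1 - ε) ε⌉₊ S) f := by
  classical
  have hε1 : ε < 1 := by linarith
  have hO0 : 0 ≤ OPT f c B := OPT_nonneg hf0 hB
  set opt := OPT f c B with hopt
  set thr := min (B - c o) ((1 - ε) * B) with hthr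
  set μ := pairLaw f c B ρ ε N₁ with hμ
  let lucky : Finset N × Finset N → Prop := fun p => cost c p.1 ≤ thr ∧ cost c p.2 ≤ thr
  set π := avg μ fun p => if lucky p then 1 else 0 with hπ
  have hthr0 : (1 - ε) * (B - c o) ≤ thr := by
    have := hc o
    refine le_min ?_ ?_ <;> nlinarith
  have hthrnn : 0 ≤ thr :=
    le_trans (mul_nonneg (by linarith) (by linarith)) hthr0
  -- Likely luck: repetition loses only a factor `1 - ε`. Unlikely luck: the density bound suffices,
  -- already for one run.
  by_cases hcase : ε ≤ π
  · rw [probe_eq_bind]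
    have hx : 0 ≤ (1 / 2 - 2 * ε) * opt / (4 + ε) :=
      div_nonneg (mul_nonneg (by linarith) hO0) (by linarith)
    have h := le_avg_bestOfRuns_of_lucky hf0 μ
      (fun p => probeFinish f c B usm N₁ N₂ p.1 p.2) lucky hx hε1 hcase ?_
      ⌈Real.logb (1 - ε) ε⌉₊ S
    · refine le_trans ?_ h
      have hK := pow_ceil_logb_le hε0 hε1
      calc (1 / 8 - ε) * opt ≤ (1 - ε) * ((1 / 2 - 2 * ε) * opt / (4 + ε)) := by
            rw [mul_div_assoc', le_div_iff₀ (by linarith)]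
            have : (1 / 8 - ε) * (4 + ε) ≤ (1 - ε) * (1 / 2 - 2 * ε) := by nlinarith
            nlinarith [mul_le_mul_of_nonneg_right this hO0]
        _ ≤ _ := mul_le_mul_of_nonneg_right (by linarith) hx
    · intro p hp hl
      obtain ⟨⟨-, -, h1⟩, h2, -, h3⟩ := pairLaw_support hf hf0 hc hB hρ hε0 hε1 hp
      have := OPT_le_of_small_cost hf hf0 hc hρ hε0 husm h1 h2 h3 hO₁ hO₂ ho hmax hOB hOPT hN₂
        hl.1 hl.2
      rw [div_le_iff₀ (by linarith)]
      linarith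
  · refine le_trans ?_ (avg_le_avg_bestOfRuns _ (ceil_logb_pos hε0 hε1) S)
    rw [probe_eq_bind, avg_bind]
    have h1 := avg_pairLaw_ge (f := f) (c := c) hf0 hc hB hρ hε0 hε1 N₁
    rw [← hμ] at h1
    have h2 : avg μ (fun p => f p.1 + f p.2) ≤
        avg μ (fun p => 2 * avg (probeFinish f c B usm N₁ N₂ p.1 p.2) f) := by
      refine avg_mono fun p _ => ?_
      obtain ⟨b1, -, b3, -⟩ := le_bestCandidate (f := f) (c := c) (B := B) N₁ p.1 p.2
      have := bestCandidate_le_avg (f := f) (c := c) (B := B) (usm := usm) N₁ N₂ p.1 p.2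
      linarith
    rw [avg_mul_left] at h2
    -- In an unlucky run one of the two costs exceeds `thr`, hence so does their sum.
    have h3 : avg μ (fun p => thr + -thr * if lucky p then 1 else 0) ≤
        avg μ (fun p => cost c p.1 + cost c p.2) := by
      refine avg_mono fun p _ => ?_
      have c1 : 0 ≤ cost c p.1 := Finset.sum_nonneg fun u _ => (hc u).le
      have c2 : 0 ≤ cost c p.2 := Finset.sum_nonneg fun u _ => (hc u).le
      split_ifs with hl
      · linarith
      · rcases not_and_or.1 hl with hl | hl <;> linarith
    rw [avg_add, avg_const, avg_mul_left, ← hπ] at h3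
    have h4 : (1 - ε) * thr ≤ thr + -thr * π := by
      nlinarith [mul_nonneg hthrnn (sub_nonneg.2 (not_le.1 hcase).le)]
    have hκ : 0 ≤ (1 - ε) ^ 2 * ρ := by positivity
    have h5 : (1 - ε) ^ 2 * ρ * ((1 - ε) * ((1 - ε) * (B - c o))) ≤
        (1 - ε) ^ 2 * ρ * avg μ (fun p => cost c p.1 + cost c p.2) := by
      refine mul_le_mul_of_nonneg_left (le_trans ?_ (h4.trans h3)) hκ
      exact mul_le_mul_of_nonneg_left hthr0 (by linarith)
    have h6 : (1 - ε) ^ 4 * ((1 - ε) * opt) ≤ (1 - ε) ^ 4 * (4 * (ρ * (B - c o))) :=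
      mul_le_mul_of_nonneg_left hlo (by positivity)
    -- Five factors `1 - ε`: two from the density, one from the probability of bad luck, one from
    -- `thr`, one from rounding `ρ`. Bernoulli gives `(1-ε)⁵/8 ≥ 1/8 - 5ε/8`.
    have h7 : 1 + (5 : ℕ) * (-ε) ≤ (1 + -ε) ^ 5 := one_add_mul_le_pow (by linarith) 5
    have h8 := mul_le_mul_of_nonneg_right h7 hO0
    push_cast at h8
    have h9 : (1 + -ε) ^ 5 * opt = (1 - ε) ^ 4 * ((1 - ε) * opt) := by ring
    have h10 : (1 - ε) ^ 2 * ρ * ((1 - ε) * ((1 - ε) * (B - c o))) =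
      (1 - ε) ^ 4 * (4 * (ρ * (B - c o))) / 4 := by ring
    nlinarith [mul_nonneg hε0.le hO0]

end Runs

/-! ### The threshold grid and the final estimate. -/

section Main

variable {N : Type u} [Fintype N] [DecidableEq N] {f : Finset N → ℝ} {c : N → ℝ} {B ε : ℝ}
  {usm : Finset N → PMF (Finset N)}

theorem mem_thresholds {lo hi ρ : ℝ} (h : ρ ∈ thresholds ε lo hi) : ρ ∈ thresholdSet ε lo hi := by
  unfold thresholds at h
  split_ifs at h with hfin
  · simpa using h
  · simp at h

theorem thresholdSet_pos (hε1 : ε < 1) {lo hi ρ : ℝ} (h : ρ ∈ thresholdSet ε lo hi) : 0 < ρ := by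
  obtain ⟨⟨z, rfl⟩, -⟩ := h
  exact zpow_pos (by linarith) _

theorem mem_thresholds_of_mem (hε0 : 0 < ε) (hε1 : ε < 1) {lo hi ρ : ℝ} (hlo : 0 < lo)
    (h : ρ ∈ thresholdSet ε lo hi) : ρ ∈ thresholds ε lo hi := by
  unfold thresholds
  rw [dif_pos (thresholdSet_finite hε0 hε1 (Or.inl hlo))]
  simpa using h

theorem exists_threshold (hε0 : 0 < ε) (hε1 : ε < 1) {x : ℝ} (hx : 0 < x) :
    ∃ z : ℤ, (1 - ε) ^ (-z) ≤ x ∧ (1 - ε) * x ≤ (1 - ε) ^ (-z) := by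
  have hε : 0 < 1 - ε := by linarith
  obtain ⟨z, hz1, hz2⟩ := exists_mem_Ico_zpow hx ((one_lt_inv₀ hε).2 (by linarith))
  refine ⟨z, by rwa [zpow_neg, ← inv_zpow], ?_⟩
  rw [zpow_add₀ (inv_ne_zero hε.ne'), zpow_one] at hz2
  rw [zpow_neg, ← inv_zpow]
  calc (1 - ε) * x ≤ (1 - ε) * ((1 - ε)⁻¹ ^ z * (1 - ε)⁻¹) := by gcongr
    _ = _ := by field_simp

theorem le_bestSingleton [Nonempty N] (f : Finset N → ℝ) (u : N) : f {u} ≤ f {bestSingleton f} :=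
  (Finite.exists_max fun u : N => f {u}).choose_spec u

theorem Submodular.le_sum_singleton (hf : Submodular f) (hf0 : ∀ X, 0 ≤ f X) {X : Finset N}
    (hX : X.Nonempty) : f X ≤ ∑ u ∈ X, f {u} := by
  induction hX using Finset.Nonempty.cons_induction with
  | singleton a => simp
  | cons a s ha hs ih =>
    rw [Finset.sum_cons]
    have h1 := hf {a} s
    have h2 := hf0 ({a} ∩ s)
    rw [Finset.cons_eq_insert, Finset.insert_eq]
    linarith

theorem cost_cheap_le [Nonempty N] (hε0 : 0 < ε) (hB : 0 < B) {X : Finset N}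
    (hX : ∀ u ∈ X, c u ≤ ε * (B / Fintype.card N)) : cost c X ≤ ε * B := by
  have hn : (0 : ℝ) < Fintype.card N := by exact_mod_cast Fintype.card_pos
  calc cost c X ≤ X.card • (ε * (B / Fintype.card N)) := Finset.sum_le_card_nsmul _ _ _ hX
    _ ≤ Fintype.card N * (ε * (B / Fintype.card N)) := by
        rw [nsmul_eq_mul]
        have : (X.card : ℝ) ≤ Fintype.card N := by exact_mod_cast Finset.card_le_univ X
        gcongr
    _ = ε * B := by field_simp

theorem feasible_of_mem_parSKP_support [Nonempty N] (hf : Submodular f) (hf0 : ∀ X, 0 ≤ f X)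
    (hc : ∀ u, 0 < c u) (hB : 0 < B) (hcB : ∀ u, c u ≤ B) (hε0 : 0 < ε) (hε1 : ε < 1)
    (husm : IsUSM (2 + ε) f usm) {α : ℝ} {S : Finset N}
    (hS : S ∈ (parSKP usm α ε f c B).support) : Feasible c B S := by
  unfold parSKP at hS
  rw [PMF.mem_support_bind_iff] at hS
  obtain ⟨T, hT, hS⟩ := hS
  refine feasible_of_mem_bestOverThresholds_support ?_ (feasible_better ?_ ?_) hS
  · intro ρ hρ R hR
    exact feasible_of_mem_probe_support hf hf0 hc hB (thresholdSet_pos hε1 (mem_thresholds hρ))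
      hε0 hε1 husm hR
  · refine Feasible.mono hc ((husm _).1 T hT) ?_
    refine (cost_cheap_le hε0 hB fun u hu => ?_).trans (by nlinarith)
    simpa using hu
  · simpa [Feasible, cost] using hcB _

theorem avg_parSKP_ge [Nonempty N] (hf : Submodular f) (hf0 : ∀ X, 0 ≤ f X)
    (hc : ∀ u, 0 < c u) (hB : 0 < B) (hcB : ∀ u, c u ≤ B) (hε0 : 0 < ε)
    (husm : IsUSM (2 + ε) f usm) :
    (1 / 8 - ε) * OPT f c B ≤ avg (parSKP usm (1 / 4) ε f c B) f := by
  have hO0 : 0 ≤ OPT f c B := OPT_nonneg hf0 hB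
  obtain ⟨O, hO, hfO⟩ := exists_eq_OPT (f := f) (c := c) hB
  unfold parSKP
  rw [avg_bind]
  set n : ℝ := ((Fintype.card N : ℕ) : ℝ) with hn
  have hn0 : 0 < n := by
    rw [hn]
    exact_mod_cast Fintype.card_pos
  set N₁ : Finset N := Finset.univ.filter fun u => ε * (B / n) < c u with hN₁
  set N₂ : Finset N := Finset.univ \ N₁ with hN₂
  set m := f {bestSingleton f} with hm
  set K := ⌈Real.logb (1 - ε) ε⌉₊ with hK
  set Z := thresholds ε (1 / 4 * m / B) (n ^ 2 * (1 / 4 * m) / (ε * B)) with hZ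
  set P := fun ρ => probe f c B usm ρ N₁ N₂ ε with hP
  set E := avg (usm N₂) fun S =>
    avg (bestOverThresholds f P K Z (better f S {bestSingleton f})) f with hE
  have hEu : avg (usm N₂) f ≤ E :=
    avg_mono fun S _ => (le_better_left _ _).trans (le_avg_bestOverThresholds _ _ _ _)
  have hEm : m ≤ E := le_avg fun S _ =>
    (le_better_right (f := f) S {bestSingleton f}).trans (le_avg_bestOverThresholds _ _ _ _)
  have hE0 : 0 ≤ E := (hf0 _).trans hEm
  -- For `ε ≥ 1/8` the claimed bound is nonpositive.
  by_cases hε8 : ε < 1 / 8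
  swap
  · exact (mul_nonpos_of_nonpos_of_nonneg (by linarith) hO0).trans hE0
  have hε1 : ε < 1 := by linarith
  by_cases hEO : OPT f c B ≤ 8 * E
  · nlinarith [mul_nonneg hε0.le hO0]
  push Not at hEO
  set O₁ := O ∩ N₁ with hO₁
  set O₂ := O \ N₁ with hO₂
  have hunion : O₁ ∪ O₂ = O := by
    ext x
    simp only [hO₁, hO₂, Finset.mem_union, Finset.mem_inter, Finset.mem_sdiff]
    tauto
  have hO₂N : O₂ ⊆ N₂ := Finset.sdiff_subset_sdiff (Finset.subset_univ _) subset_rfl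
  have hfO₂ : f O₂ ≤ (2 + ε) * E :=
    ((husm N₂).2 O₂ hO₂N).trans (mul_le_mul_of_nonneg_left hEu (by linarith))
  have hsplit := hf O₁ O₂
  rw [hunion, hfO] at hsplit
  have hinter := hf0 (O₁ ∩ O₂)
  rcases O₁.eq_empty_or_nonempty with hemp | hne
  · rw [hemp, Finset.empty_union] at hunion
    rw [← hunion] at hfO
    nlinarith
  obtain ⟨o, ho, hmax⟩ := Finset.exists_max_image O₁ c hne
  -- If `O₁ = {o}`, then `OPT ≤ f({o}) + f(O₂) ≤ (3+ε)E`, against `OPT > 8E`.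
  obtain ⟨o', ho', hoo'⟩ : ∃ o' ∈ O₁, o' ≠ o := by
    by_contra hcon
    push Not at hcon
    have h1 : O₁ = {o} := Finset.eq_singleton_iff_unique_mem.2 ⟨ho, hcon⟩
    have h2 := le_bestSingleton f o
    rw [← h1] at h2
    nlinarith
  have hOB : cost c O₁ ≤ B := (cost_mono hc Finset.inter_subset_left).trans hO
  -- The second expensive element `o'` also fits into the budget.
  have hβ : ε * (B / n) < B - c o := by
    have h1 : c o' + c o ≤ cost c O₁ := by
      have : ({o', o} : Finset N) ⊆ O₁ := by
        intro x hx
        rcases Finset.mem_insert.1 hx with rfl | hx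
        · exact ho'
        · exact Finset.mem_singleton.1 hx ▸ ho
      refine le_trans (le_of_eq ?_) (cost_mono hc this)
      unfold cost
      rw [Finset.sum_pair hoo']
    have h2 : ε * (B / n) < c o' := (Finset.mem_filter.1 (Finset.mem_inter.1 ho').2).2
    linarith
  have hβ0 : 0 < B - c o := lt_trans (by positivity) hβ
  have hOn : OPT f c B ≤ n * m := by
    rw [← hfO]
    have hOne : O.Nonempty := ⟨o, Finset.mem_of_mem_inter_left ho⟩
    refine (hf.le_sum_singleton hf0 hOne).trans
      ((Finset.sum_le_card_nsmul _ _ m fun u _ => le_bestSingleton f u).trans ?_)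
    rw [nsmul_eq_mul]
    have : (O.card : ℝ) ≤ n := by
      rw [hn]
      exact_mod_cast Finset.card_le_univ O
    exact mul_le_mul_of_nonneg_right this (hf0 _)
  have hOpos : 0 < OPT f c B := by linarith
  have hmpos : 0 < m := by
    by_contra hcon
    push Not at hcon
    nlinarith
  obtain ⟨z, hz1, hz2⟩ := exists_threshold hε0 hε1
    (x := OPT f c B / (4 * (B - c o))) (by positivity)
  set ρ := (1 - ε) ^ (-z) with hρ
  have hρ0 : 0 < ρ := zpow_pos (by linarith) _
  rw [le_div_iff₀ (by positivity)] at hz1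
  rw [mul_div_assoc', div_le_iff₀ (by positivity)] at hz2
  -- The lower end uses `OPT > 8E ≥ 8m`, which leaves room for rounding down; the upper end uses
  -- `OPT ≤ nm` and `B - c(o) > εB/n`.
  have hmem : ρ ∈ Z := by
    refine mem_thresholds_of_mem hε0 hε1 (by positivity) ⟨⟨z, rfl⟩, ?_, ?_⟩
    · rw [div_le_iff₀ hB]
      have h1 := mul_pos hρ0 (hc o)
      nlinarith
    · rw [le_div_iff₀ (by positivity)]
      have h1 : ε * B < n * (B - c o) := by
        have := mul_lt_mul_of_pos_left hβ hn0
        have h2 : n * (ε * (B / n)) = ε * B := by field_simp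
        linarith
      calc ρ * (ε * B) ≤ ρ * (n * (B - c o)) := by gcongr
        _ = n * (ρ * (4 * (B - c o))) / 4 := by ring
        _ ≤ n * (n * m) / 4 := by
            have := hz1.trans hOn
            gcongr
        _ = _ := by ring
  refine le_avg fun S _ => le_avg_bestOverThresholds_of_mem hmem (fun T => ?_) _
  refine le_avg_bestOfRuns_probe hf hf0 hc hB hρ0 hε0 hε8 husm Finset.inter_subset_right hO₂N ho
    hmax hOB (by rw [hunion, hfO]) ?_ (hcB o) (by linarith) (by linarith) T
  refine cost_cheap_le hε0 hB fun u hu => ?_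
  simpa [hN₂, hN₁] using hu

end Main

end KnapsackSubmodular

theorem mainTheorem1 {N : Type*} [Fintype N] [DecidableEq N] [Nonempty N]
    (f : Finset N → ℝ) (hf : KnapsackSubmodular.Submodular f) (hf0 : ∀ X, 0 ≤ f X)
    (c : N → ℝ) (B : ℝ) (hc : ∀ u, 0 < c u) (hB : 0 < B) (hcB : ∀ u, c u ≤ B)
    (ε : ℝ) (hε0 : 0 < ε) (hε1 : ε < 1)
    (usm : Finset N → PMF (Finset N)) (husm : KnapsackSubmodular.IsUSM (2 + ε) f usm) :
    (∀ S ∈ (KnapsackSubmodular.parSKP usm (1 / 4) ε f c B).support,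
      KnapsackSubmodular.Feasible c B S) ∧
    (1 / 8 - ε) * KnapsackSubmodular.OPT f c B ≤
      KnapsackSubmodular.expect (KnapsackSubmodular.parSKP usm (1 / 4) ε f c B) f :=
  ⟨fun _ hS => KnapsackSubmodular.feasible_of_mem_parSKP_support hf hf0 hc hB hcB hε0 hε1 husm hS,
    KnapsackSubmodular.avg_parSKP_ge hf hf0 hc hB hcB hε0 husm⟩
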